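/- Call a probability measure $\mu$ on $\mathbb R^n$ a *regular log-concave measure* if it has a density $e^{-\psi}$ with respect to Lebesgue measure, where $\psi:\mathbb R^n\to\mathbb R$ is smooth, $\varepsilon\,\mathrm{Id}\le\nabla^2\psi(x)\le\varepsilon^{-1}\,\mathrm{Id}$ for all $x$ and some $\varepsilon>0$, and $\psi$ and each of its partial derivatives (of every order) grow at most polynomially at infinity. Let $C_P(\mu)\in[0,\infty]$ be the Poincaré constant, i.e. the smallest $C$ such that $\int f^2\,d\mu\le C\int|\nabla f|^2\,d\mu$ for every $\mu$-integrable $C^1$ function $f:\mathbb R^n\to\mathbb R$ with $\int f\,d\mu=0$; let $\mathrm{Cov}(\mu)$ be the covariance matrix of $\mu$ and $\|\cdot\|_{op}$ the operator norm with respect to the Euclidean norm. **Theorem (improved log-concave Lichnerowicz inequality).** Let $\mu$ be a regular log-concave probability measure on $\mathbb R^n$ with density $e^{-\psi}$, let $t>0$, and assume that $\nabla^2\psi(x)\ge t\,\mathrm{Id}$ for all $x\in\mathbb R^n$. Then $$C_P(\mu)\le\sqrt{\|\mathrm{Cov}(\mu)\|_{op}\cdot\frac1t}.$$ Equality is attained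 by Gaussian measures: if $n\ge1$ and $\mu$ is a Gaussian measure on $\mathbb R^n$ with positive definite covariance matrix, then $\mu$ is a regular log-concave measure, with some density $e^{-\psi}$; there is a largest number $t$ with $\nabla^2\psi(x)\ge t\,\mathrm{Id}$ for all $x$; it is positive; and for this $t$, $$C_P(\mu)=\|\mathrm{Cov}(\mu)\|_{op}=\frac1t=\sqrt{\|\mathrm{Cov}(\mu)\|_{op}\cdot\frac1t}.$$ -/

import Mathlib

open MeasureTheory ProbabilityTheory

noncomputable section

/-- The Euclidean space `ℝⁿ`. -/
abbrev Euc (n : ℕ) : Type := EuclideanSpace ℝ (Fin n)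

/-- The quadratic form `v ↦ ⟨∇²ψ(x) v, v⟩` of the Hessian of `ψ` at `x`. -/
def hessForm {n : ℕ} (ψ : Euc n → ℝ) (x v : Euc n) : ℝ :=
  fderiv ℝ (fderiv ℝ ψ) x v v

/-- `∇²ψ(x) ≥ t · Id` for all `x`. -/
def HessGE {n : ℕ} (ψ : Euc n → ℝ) (t : ℝ) : Prop :=
  ∀ x v : Euc n, t * ‖v‖ ^ 2 ≤ hessForm ψ x v

/-- `∇²ψ(x) ≤ t · Id` for all `x`. -/
def HessLE {n : ℕ} (ψ : Euc n → ℝ) (t : ℝ) : Prop :=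
  ∀ x v : Euc n, hessForm ψ x v ≤ t * ‖v‖ ^ 2

/-- `μ` is a regular log-concave measure on `ℝⁿ` with density `e^{-ψ}`: the function `ψ` is smooth,
`ε · Id ≤ ∇²ψ ≤ ε⁻¹ · Id` everywhere for some `ε > 0`, and `ψ` and all its partial derivatives grow
at most polynomially (`Function.HasTemperateGrowth` includes smoothness). -/
structure IsRegularLogConcave {n : ℕ} (μ : Measure (Euc n)) (ψ : Euc n → ℝ) : Prop where
  density : μ = volume.withDensity (fun x => ENNReal.ofReal (Real.exp (-ψ x)))
  temperate : Function.HasTemperateGrowth ψ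
  hess_bounds : ∃ ε : ℝ, 0 < ε ∧ HessGE ψ ε ∧ HessLE ψ (1 / ε)

/-- The Poincaré constant `C_P(μ)`: the smallest `C ∈ [0, ∞]` such that `∫ f² dμ ≤ C ∫ |∇f|² dμ`
for all `C¹` functions `f` with `∫ f dμ = 0`; it is `∞` if there is no finite such `C`.
Both sides are integrals of nonnegative functions with values in `[0, ∞]`. -/
def poincareConst {n : ℕ} (μ : Measure (Euc n)) : ENNReal :=
  sInf {C : ENNReal | ∀ f : Euc n → ℝ, ContDiff ℝ 1 f → Integrable f μ → ∫ x, f x ∂μ = 0 →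
    ∫⁻ x, ‖f x‖ₑ ^ 2 ∂μ ≤ C * ∫⁻ x, ‖gradient f x‖ₑ ^ 2 ∂μ}

/-- The covariance matrix of `μ`. -/
def covMat {n : ℕ} (μ : Measure (Euc n)) : Matrix (Fin n) (Fin n) ℝ :=
  Matrix.of fun i j => covariance (fun x : Euc n => x i) (fun x : Euc n => x j) μ

/-- The operator norm of a square matrix acting on Euclidean space. -/
def matOpNorm {n : ℕ} (A : Matrix (Fin n) (Fin n) ℝ) : ℝ :=
  ‖Matrix.toEuclideanCLM (n := Fin n) (𝕜 := ℝ) A‖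

end

/-! Write L for `gen ψ`, V for the operator norm of the covariance, and call λ a spectral gap if λ
Var f ≤ ∫|∇f|². Bochner's formula `integral_gen_sq` expresses ∫(Lu)² as Σᵢ ∫|∇∂ᵢu|² plus the Hessian
of ψ evaluated on ∇u. The classical Lichnerowicz argument discards the first sum. Here a known gap λ
is applied to each ∂ᵢu, which gives λ∫|∇u|² minus λ|∫∇u|². The loss is controlled by the covariance:
Green's formula against a centred linear function and Cauchy–Schwarz give |∫∇u|² ≤ V∫(Lu)²
(`sum_integral_pd_sq_le`). Together, (λ+t)∫|∇u|² ≤ (1+λV)∫(Lu)² (`gap_energy_le`).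

By duality a gap λ therefore improves to (λ+t)/(1+λV) (`SpectralGap.improve`). This exceeds λ
exactly when λ²V < t. Starting from the trivial gap 0, the supremum of the gaps below s cannot stop
before s as long as s²V ≤ t (`spectralGap_of_sq_mul_le`), which is the claimed bound.

No eigenfunction and no solution of Lu = f is used. It suffices that L maps test functions onto a
dense subspace of the centred L² functions, that is, that a function v orthogonal to this range is
constant (`ae_eq_const_of_orthogonal_gen`). The function h = e^{-ψ/2}v lies in L²(dx) and solves a
Schrödinger equation in the distributional sense. Its mollifications satisfy a Caccioppoli
inequality with a residual that vanishes in the limit, and cutoffs with gradient of order 1/R then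
force the weak gradient of v to vanish. No growth bound on the potential enters.

A Gaussian measure is the image of the standard one under an affine map with linear part the square
root of the covariance. Its potential has constant Hessian, linear functions bound the Poincaré
constant from below, and the inequality just proved bounds it from above. -/

open scoped ContDiff

/-! ### Partial derivatives and the weighted Laplacian -/

section Calculus

variable {n : ℕ}

/-- The `i`-th partial derivative. -/
noncomputable def pd (i : Fin n) (f : Euc n → ℝ) : Euc n → ℝ :=
  fun x => fderiv ℝ f x (EuclideanSpace.single i 1)

/-- The weighted Laplacian `Δf - ⟨∇ψ, ∇f⟩`. -/
noncomputable def gen (ψ f : Euc n → ℝ) : Euc n → ℝ :=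
  fun x => ∑ i, (pd i (pd i f) x - pd i ψ x * pd i f x)

lemma ContDiff.pd {f : Euc n → ℝ} (hf : ContDiff ℝ ∞ f) (i : Fin n) : ContDiff ℝ ∞ (pd i f) :=
  (hf.fderiv_right (m := ∞) (by norm_num)).clm_apply contDiff_const

lemma ContDiff.continuous_pd {f : Euc n → ℝ} (hf : ContDiff ℝ 1 f) (i : Fin n) :
    Continuous (_root_.pd i f) :=
  (hf.continuous_fderiv (by norm_num)).clm_apply continuous_const

lemma HasCompactSupport.pd {f : Euc n → ℝ} (hf : HasCompactSupport f) (i : Fin n) :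
    HasCompactSupport (pd i f) :=
  hf.fderiv_apply (𝕜 := ℝ) _

lemma ContDiff.gen {ψ f : Euc n → ℝ} (hψ : ContDiff ℝ ∞ ψ) (hf : ContDiff ℝ ∞ f) :
    ContDiff ℝ ∞ (gen ψ f) :=
  ContDiff.sum fun i _ => (((hf.pd i).pd i).sub ((hψ.pd i).mul (hf.pd i)))

lemma HasCompactSupport.gen {f : Euc n → ℝ} (ψ : Euc n → ℝ) (hf : HasCompactSupport f) :
    HasCompactSupport (gen ψ f) := by
  refine hf.mono' fun x hx => ?_
  contrapose! hx
  have h1 : ∀ i, _root_.pd i f x = 0 := fun i =>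
    image_eq_zero_of_notMem_tsupport fun h => hx (tsupport_fderiv_apply_subset ℝ _ h)
  have h2 : ∀ i, _root_.pd i (_root_.pd i f) x = 0 := fun i =>
    image_eq_zero_of_notMem_tsupport fun h => hx
      (tsupport_fderiv_apply_subset ℝ _ (tsupport_fderiv_apply_subset ℝ _ h))
  simp [_root_.gen, h1, h2]

lemma pd_mul {f g : Euc n → ℝ} {x : Euc n} (hf : DifferentiableAt ℝ f x)
    (hg : DifferentiableAt ℝ g x) (i : Fin n) :
    pd i (fun y => f y * g y) x = f x * pd i g x + g x * pd i f x := by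
  simp [pd, fderiv_fun_mul hf hg]

lemma pd_sum {ι : Type*} {s : Finset ι} {f : ι → Euc n → ℝ} {x : Euc n}
    (hf : ∀ j ∈ s, DifferentiableAt ℝ (f j) x) (i : Fin n) :
    pd i (fun y => ∑ j ∈ s, f j y) x = ∑ j ∈ s, pd i (f j) x := by
  simp [pd, fderiv_fun_sum hf]

lemma pd_sub {f g : Euc n → ℝ} {x : Euc n} (hf : DifferentiableAt ℝ f x)
    (hg : DifferentiableAt ℝ g x) (i : Fin n) :
    pd i (fun y => f y - g y) x = pd i f x - pd i g x := by
  simp [pd, fderiv_fun_sub hf hg]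

lemma pd_exp {f : Euc n → ℝ} {x : Euc n} (hf : DifferentiableAt ℝ f x) (i : Fin n) :
    pd i (fun y => Real.exp (f y)) x = Real.exp (f x) * pd i f x := by
  simp [pd, fderiv_exp hf]

lemma pd_neg {f : Euc n → ℝ} {x : Euc n} (i : Fin n) :
    pd i (fun y => - f y) x = - pd i f x := by
  simp [pd, fderiv_fun_neg]

lemma pd_comp_const_sub {f : Euc n → ℝ} (hf : ContDiff ℝ ∞ f) (i : Fin n) (x : Euc n) :
    pd i (fun y => f (x - y)) = fun y => - pd i f (x - y) := by
  ext y
  have hd : HasFDerivAt (fun y => f (x - y)) ((fderiv ℝ f (x - y)).comp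
      (-ContinuousLinearMap.id ℝ (Euc n))) y :=
    HasFDerivAt.comp y (hf.differentiable (by norm_num) (x - y)).hasFDerivAt
      ((hasFDerivAt_id y).const_sub x)
  simp only [pd]
  rw [hd.fderiv]
  simp

lemma pd_pd_apply {f : Euc n → ℝ} (hf : ContDiff ℝ ∞ f) (i j : Fin n) (x : Euc n) :
    pd i (pd j f) x =
      fderiv ℝ (fderiv ℝ f) x (EuclideanSpace.single i 1) (EuclideanSpace.single j 1) := by
  have h : DifferentiableAt ℝ (fderiv ℝ f) x :=
    ((hf.fderiv_right (m := ∞) (by norm_num)).differentiable (by norm_num)) x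
  change fderiv ℝ (fun y => fderiv ℝ f y (EuclideanSpace.single j 1)) x _ = _
  rw [fderiv_clm_apply h (differentiableAt_const _)]
  simp

lemma pd_comm {f : Euc n → ℝ} (hf : ContDiff ℝ ∞ f) (i j : Fin n) :
    pd i (pd j f) = pd j (pd i f) := by
  ext x
  rw [pd_pd_apply hf, pd_pd_apply hf]
  exact (hf.contDiffAt.isSymmSndFDerivAt (by simpa using WithTop.coe_le_coe.2 (le_top (a := (2 : ℕ∞))))).eq _ _

lemma hessForm_eq_sum {ψ : Euc n → ℝ} (hψ : ContDiff ℝ ∞ ψ) (x v : Euc n) :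
    hessForm ψ x v = ∑ i, ∑ j, v i * v j * pd i (pd j ψ) x := by
  have hv : v = ∑ i, v i • EuclideanSpace.single i (1 : ℝ) := by
    have := (EuclideanSpace.basisFun (Fin n) ℝ).sum_repr v
    simpa using this.symm
  rw [hessForm]
  conv_lhs => rw [hv]
  simp only [map_sum, sum_apply, map_smul, smul_apply,
    smul_eq_mul, pd_pd_apply hψ, Finset.mul_sum]
  rw [Finset.sum_comm]
  exact Finset.sum_congr rfl fun i _ => Finset.sum_congr rfl fun j _ => by ring

lemma norm_gradient_sq (f : Euc n → ℝ) (x : Euc n) :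
    ‖gradient f x‖ ^ 2 = ∑ i, pd i f x ^ 2 := by
  rw [EuclideanSpace.norm_sq_eq]
  refine Finset.sum_congr rfl fun i _ => ?_
  have : gradient f x i = pd i f x := by
    have h : inner ℝ (gradient f x) (EuclideanSpace.single i (1 : ℝ)) = pd i f x := by
      rw [gradient, InnerProductSpace.toDual_symm_apply, pd]
    rw [← h]
    rw [EuclideanSpace.inner_single_right]; simp
  rw [this, Real.norm_eq_abs, sq_abs]

lemma integral_pd_eq_zero {F : Euc n → ℝ} (hF : ContDiff ℝ 1 F) (hc : HasCompactSupport F)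
    (i : Fin n) : ∫ x, pd i F x = 0 := by
  have hF1 : Integrable (fun x => fderiv ℝ F x (EuclideanSpace.single i 1)) volume :=
    (hF.continuous_pd i).integrable_of_hasCompactSupport (hc.pd i)
  -- Integration by parts against the constant function 1.
  have h := integral_mul_fderiv_eq_neg_fderiv_mul_of_integrable (μ := volume)
    (f := fun _ : Euc n => (1 : ℝ)) (g := F) (v := EuclideanSpace.single i 1)
    (by simp) (by simpa only [one_mul] using hF1)
    (by simpa using hF.continuous.integrable_of_hasCompactSupport hc)
    (fun _ _ => differentiableAt_const _) (fun x _ => hF.differentiable (by norm_num) x)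
  simpa [pd] using h

end Calculus

/-! ### Green's and Bochner's formulas for the weighted measure -/

section Weighted

variable {n : ℕ} {ψ : Euc n → ℝ}

/-- The measure with density `e^{-ψ}`. -/
noncomputable def weighted (ψ : Euc n → ℝ) : Measure (Euc n) :=
  volume.withDensity (fun x => ENNReal.ofReal (Real.exp (-ψ x)))

lemma integral_weighted (hψ : Continuous ψ) (g : Euc n → ℝ) :
    ∫ x, g x ∂(weighted ψ) = ∫ x, g x * Real.exp (-ψ x) := by
  rw [weighted, integral_withDensity_eq_integral_toReal_smul (by fun_prop) (by simp)]
  refine integral_congr_ae (Filter.Eventually.of_forall fun x => ?_)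
  simp [ENNReal.toReal_ofReal (Real.exp_pos _).le, mul_comm]

lemma integrable_weighted_iff (hψ : Continuous ψ) {g : Euc n → ℝ} :
    Integrable g (weighted ψ) ↔ Integrable (fun x => g x * Real.exp (-ψ x)) := by
  rw [weighted, integrable_withDensity_iff (by fun_prop) (by simp)]
  simp only [ENNReal.toReal_ofReal (Real.exp_pos _).le]

/-- Green's formula for the weighted Laplacian. -/
lemma integral_gen_mul [IsFiniteMeasure (weighted ψ)] (hψ : ContDiff ℝ ∞ ψ) {u g : Euc n → ℝ}
    (hu : ContDiff ℝ ∞ u) (hg : ContDiff ℝ 1 g) (hc : HasCompactSupport u ∨ HasCompactSupport g) :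
    ∫ x, gen ψ u x * g x ∂(weighted ψ) = - ∫ x, ∑ i, pd i u x * pd i g x ∂(weighted ψ) := by
  have hc1 : ∀ i, HasCompactSupport fun x => pd i u x * g x := fun i =>
    hc.elim (fun h => (h.pd i).mul_right) (fun h => h.mul_left)
  have hc2 : HasCompactSupport fun x => gen ψ u x * g x :=
    hc.elim (fun h => (h.gen ψ).mul_right) (fun h => h.mul_left)
  have hc3 : ∀ i, HasCompactSupport fun x => pd i u x * pd i g x := fun i =>
    hc.elim (fun h => (h.pd i).mul_right) (fun h => (h.pd i).mul_left)
  have i2 : Integrable (fun x => gen ψ u x * g x) (weighted ψ) :=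
    ((hψ.gen hu).continuous.mul hg.continuous).integrable_of_hasCompactSupport hc2
  have i3 : Integrable (fun x => ∑ i, pd i u x * pd i g x) (weighted ψ) :=
    integrable_finsetSum _ fun i _ =>
      ((hu.pd i).continuous.mul (hg.continuous_pd i)).integrable_of_hasCompactSupport (hc3 i)
  have hρ : ContDiff ℝ 1 fun x => Real.exp (-ψ x) := (hψ.of_le (by norm_num)).neg.exp
  have hF : ∀ i, ContDiff ℝ 1 fun x => (pd i u x * g x) * Real.exp (-ψ x) := fun i =>
    (((hu.pd i).of_le (by norm_num)).mul hg).mul hρ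
  have hFc : ∀ i, HasCompactSupport fun x => (pd i u x * g x) * Real.exp (-ψ x) := fun i =>
    (hc1 i).mul_right
  rw [eq_neg_iff_add_eq_zero, ← integral_add i2 i3, integral_weighted hψ.continuous]
  -- The combined integrand is the divergence of the compactly supported field `g e^{-ψ} ∇u`.
  calc _ = ∫ x, ∑ i, pd i (fun y => (pd i u y * g y) * Real.exp (-ψ y)) x := by
        refine integral_congr_ae (Filter.Eventually.of_forall fun x => ?_)
        have hg' := hg.differentiable (by norm_num) x
        have hψ' := hψ.differentiable (by norm_num) x
        simp only [gen]
        rw [Finset.sum_mul, ← Finset.sum_add_distrib, Finset.sum_mul]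
        refine Finset.sum_congr rfl fun i _ => ?_
        have hu' := (hu.pd i).differentiable (by norm_num) x
        rw [pd_mul (hu'.fun_mul hg') hψ'.fun_neg.exp, pd_mul hu' hg', pd_exp hψ'.fun_neg, pd_neg]
        ring
    _ = 0 := by
        rw [integral_finsetSum _ fun i _ =>
          ((hF i).continuous_pd i).integrable_of_hasCompactSupport ((hFc i).pd i)]
        exact Finset.sum_eq_zero fun i _ => integral_pd_eq_zero (hF i) (hFc i) i

/-- Third derivatives of `u` commute, so the commutator only sees the derivative that falls on ∇ψ.
This is where the Hessian of ψ enters Bochner's formula. -/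
lemma pd_gen (hψ : ContDiff ℝ ∞ ψ) {u : Euc n → ℝ} (hu : ContDiff ℝ ∞ u) (i : Fin n) (x : Euc n) :
    pd i (gen ψ u) x = gen ψ (pd i u) x - ∑ j, pd i (pd j ψ) x * pd j u x := by
  have d : ∀ {f : Euc n → ℝ}, ContDiff ℝ ∞ f → DifferentiableAt ℝ f x := fun hf =>
    hf.differentiable (by norm_num) x
  unfold gen
  rw [pd_sum fun j _ => (d ((hu.pd j).pd j)).fun_sub ((d (hψ.pd j)).fun_mul (d (hu.pd j))),
    ← Finset.sum_sub_distrib]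
  refine Finset.sum_congr rfl fun j _ => ?_
  rw [pd_sub (d ((hu.pd j).pd j)) ((d (hψ.pd j)).fun_mul (d (hu.pd j))),
    pd_mul (d (hψ.pd j)) (d (hu.pd j)), pd_comm (hu.pd j) i j, pd_comm hu i j]
  ring

/-- The integrated Bochner formula. -/
lemma integral_gen_sq [IsFiniteMeasure (weighted ψ)] (hψ : ContDiff ℝ ∞ ψ) {u : Euc n → ℝ}
    (hu : ContDiff ℝ ∞ u) (hc : HasCompactSupport u) :
    ∫ x, gen ψ u x ^ 2 ∂(weighted ψ) =
      ∑ i, ∫ x, ∑ j, pd j (pd i u) x ^ 2 ∂(weighted ψ) +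
        ∫ x, ∑ i, ∑ j, pd i u x * pd j u x * pd i (pd j ψ) x ∂(weighted ψ) := by
  have hL := hψ.gen hu
  have e1 : ∀ i, ∫ x, ∑ j, pd j (pd i u) x ^ 2 ∂(weighted ψ) =
      - ∫ x, gen ψ (pd i u) x * pd i u x ∂(weighted ψ) := fun i => by
    rw [integral_gen_mul hψ (hu.pd i) ((hu.pd i).of_le (by norm_num)) (Or.inl (hc.pd i)), neg_neg]
    simp only [sq]
  have i1 : ∀ i, Integrable (fun x => gen ψ (pd i u) x * pd i u x) (weighted ψ) := fun i =>
    ((hψ.gen (hu.pd i)).continuous.mul (hu.pd i).continuous).integrable_of_hasCompactSupport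
      (hc.pd i).mul_left
  have i2 : Integrable (fun x => ∑ i, ∑ j, pd i u x * pd j u x * pd i (pd j ψ) x) (weighted ψ) :=
    integrable_finsetSum _ fun i _ => integrable_finsetSum _ fun j _ =>
      (((hu.pd i).continuous.mul (hu.pd j).continuous).mul
        ((hψ.pd j).pd i).continuous).integrable_of_hasCompactSupport ((hc.pd i).mul_right.mul_right)
  -- Green's formula is used twice: here with `gen ψ u` as second factor, and in `e1` for each `pd i
  -- u`. The difference is the commutator term of `pd_gen`.
  have e0 : ∫ x, gen ψ u x ^ 2 ∂(weighted ψ) =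
      - ∫ x, ∑ i, pd i u x * pd i (gen ψ u) x ∂(weighted ψ) := by
    rw [← integral_gen_mul hψ hu (hL.of_le (by norm_num)) (Or.inl hc)]
    simp only [sq]
  rw [e0, Finset.sum_congr rfl fun i _ => e1 i, Finset.sum_neg_distrib,
    ← integral_finsetSum _ fun i _ => i1 i, neg_add_eq_sub, ← integral_sub i2
    (integrable_finsetSum _ fun i _ => i1 i), ← integral_neg]
  refine integral_congr_ae (Filter.Eventually.of_forall fun x => ?_)
  simp only [pd_gen hψ hu, ← Finset.sum_sub_distrib, ← Finset.sum_neg_distrib]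
  refine Finset.sum_congr rfl fun i _ => ?_
  rw [mul_sub, Finset.mul_sum, neg_sub, mul_comm (gen _ _ _)]
  congr 1
  exact Finset.sum_congr rfl fun j _ => by ring

end Weighted

/-! ### Mollification -/

section Mollification

open Filter Topology

variable {n : ℕ}

/-- The convolution `ξ * h`. -/
noncomputable def conv (ξ h : Euc n → ℝ) : Euc n → ℝ := fun x => ∫ y, ξ (x - y) * h y

lemma conv_eq_convolution (ξ h : Euc n → ℝ) :
    conv ξ h = convolution ξ h (ContinuousLinearMap.lsmul ℝ ℝ) volume := by
  ext x
  rw [convolution_eq_swap]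
  rfl

lemma conv_eq_convolution_mul (ξ h : Euc n → ℝ) :
    conv ξ h = convolution h ξ (ContinuousLinearMap.mul ℝ ℝ) volume := by
  ext x
  simp only [conv, convolution, ContinuousLinearMap.mul_apply', mul_comm]

lemma conv_eq_integral_sub (ξ h : Euc n → ℝ) (x : Euc n) :
    conv ξ h x = ∫ y, ξ y * h (x - y) := by
  rw [conv_eq_convolution]
  rfl

lemma ContDiff.conv {ξ h : Euc n → ℝ} (hξ : ContDiff ℝ ∞ ξ) (hc : HasCompactSupport ξ)
    (hh : LocallyIntegrable h volume) : ContDiff ℝ ∞ (conv ξ h) := by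
  rw [conv_eq_convolution_mul]
  exact hc.contDiff_convolution_right _ hh hξ

lemma pd_conv {ξ h : Euc n → ℝ} (hξ : ContDiff ℝ ∞ ξ) (hc : HasCompactSupport ξ)
    (hh : LocallyIntegrable h volume) (i : Fin n) : pd i (conv ξ h) = conv (pd i ξ) h := by
  ext x
  have h1 : ContDiff ℝ 1 ξ := hξ.of_le (by norm_num)
  rw [conv_eq_convolution_mul, conv_eq_convolution_mul, pd,
    (hc.hasFDerivAt_convolution_right _ hh h1 x).fderiv,
    convolution_precompR_apply _ hh (hc.fderiv ℝ) (h1.continuous_fderiv (by norm_num))]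
  rfl

/-- A sequence of bump functions shrinking to the origin. -/
noncomputable def shrinkingBump (n k : ℕ) : ContDiffBump (0 : Euc n) where
  rIn := 1 / (2 * (k + 1))
  rOut := 1 / (k + 1)
  rIn_pos := by positivity
  rIn_lt_rOut := by
    apply one_div_lt_one_div_of_lt <;> linarith [(Nat.cast_nonneg k : (0 : ℝ) ≤ k)]

/-- An approximate identity of smooth, compactly supported probability densities. -/
noncomputable def mollifier (n k : ℕ) : Euc n → ℝ := (shrinkingBump n k).normed volume

lemma contDiff_mollifier (k : ℕ) : ContDiff ℝ ∞ (mollifier n k) :=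
  (shrinkingBump n k).contDiff_normed

lemma hasCompactSupport_mollifier (k : ℕ) : HasCompactSupport (mollifier n k) :=
  (shrinkingBump n k).hasCompactSupport_normed

lemma mollifier_nonneg (k : ℕ) (x : Euc n) : 0 ≤ mollifier n k x :=
  (shrinkingBump n k).nonneg_normed x

lemma integral_mollifier (k : ℕ) : ∫ x, mollifier n k x = 1 :=
  (shrinkingBump n k).integral_normed

lemma mollifier_eq_zero {k : ℕ} {x : Euc n} (hx : 1 / ((k : ℝ) + 1) ≤ ‖x‖) :
    mollifier n k x = 0 := by
  have : x ∉ Function.support (mollifier n k) := by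
    rw [mollifier, (shrinkingBump n k).support_normed_eq]
    simpa [shrinkingBump] using hx
  simpa using this

lemma tendsto_shrinkingBump_rOut : Tendsto (fun k => (shrinkingBump n k).rOut) atTop (𝓝 0) :=
  tendsto_one_div_add_atTop_nhds_zero_nat

lemma ae_tendsto_conv_mollifier {h : Euc n → ℝ} (hh : LocallyIntegrable h volume) :
    ∀ᵐ x, Tendsto (fun k => conv (mollifier n k) h x) atTop (𝓝 (h x)) := by
  simp only [conv_eq_convolution]
  refine ContDiffBump.ae_convolution_tendsto_right_of_locallyIntegrable (K := 2)
    tendsto_shrinkingBump_rOut (Eventually.of_forall fun k => ?_) hh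
  simp only [shrinkingBump]
  apply le_of_eq
  have : (k : ℝ) + 1 ≠ 0 := by positivity
  field_simp

/-- The probability measure with density `mollifier n k`. -/
noncomputable def mollifierMeasure (n k : ℕ) : Measure (Euc n) :=
  volume.withDensity fun y => ENNReal.ofReal (mollifier n k y)

instance (k : ℕ) : IsProbabilityMeasure (mollifierMeasure n k) := by
  refine ⟨?_⟩
  rw [mollifierMeasure, withDensity_apply _ MeasurableSet.univ, setLIntegral_univ,
    ← ofReal_integral_eq_lintegral_ofReal
      ((contDiff_mollifier k).continuous.integrable_of_hasCompactSupport
        (hasCompactSupport_mollifier k)) (Eventually.of_forall (mollifier_nonneg k)),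
    integral_mollifier, ENNReal.ofReal_one]

/-- Translations form a continuous family of measure-preserving maps, and composition with such a
family is continuous in L². The form with `∫⁻` is the one that Tonelli produces when mollifying. -/
lemma continuous_translation_Lp {h : Euc n → ℝ} (hh : MemLp h 2 volume) :
    Tendsto (fun y : Euc n => ∫⁻ x, ‖h (x - y) - h x‖ₑ ^ 2) (𝓝 0) (𝓝 0) := by
  let g : Euc n → C(Euc n, Euc n) := fun y => ⟨fun x => x - y, by fun_prop⟩
  have hg : Continuous g := by
    apply ContinuousMap.continuous_of_continuous_uncurry
    simp only [g, Function.uncurry_def, ContinuousMap.coe_mk]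
    fun_prop
  have hgm : ∀ y, MeasurePreserving (g y) volume volume := fun y =>
    measurePreserving_sub_right volume y
  have : Fact ((1 : ENNReal) ≤ 2) := ⟨by norm_num⟩
  have hT := (continuous_const (y := hh.toLp h)).compMeasurePreservingLp hg hgm (by norm_num)
  have h0 := hT.tendsto 0
  rw [tendsto_iff_edist_tendsto_0] at h0
  have h1 := ((ENNReal.continuous_pow 2).tendsto 0).comp h0
  simp only [ne_eq, OfNat.ofNat_ne_zero, not_false_eq_true, zero_pow] at h1
  refine h1.congr fun y => ?_
  simp only [Function.comp_apply]
  rw [Lp.toLp_compMeasurePreserving hh, Lp.toLp_compMeasurePreserving hh, Lp.edist_toLp_toLp,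
    eLpNorm_eq_lintegral_rpow_enorm_toReal (by norm_num) (by norm_num)]
  simp only [ENNReal.toReal_ofNat]
  rw [← ENNReal.rpow_natCast, ← ENNReal.rpow_mul]
  norm_num
  simp [g]

/-- Mollifications of an `L²` function converge in `L²`. -/
lemma tendsto_lintegral_conv_mollifier_sub {h : Euc n → ℝ} (hh : MemLp h 2 volume) :
    Tendsto (fun k => ∫⁻ x, ‖conv (mollifier n k) h x - h x‖ₑ ^ 2) atTop (𝓝 0) := by
  -- Tonelli needs joint measurability of `h (x - y)`; changing `h` on a null set does not affect
  -- its mollifications.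
  wlog hm : StronglyMeasurable h generalizing h
  · obtain ⟨g, hg, hhg⟩ := hh.1
    have := this (hh.ae_eq hhg) hg
    refine this.congr fun k => lintegral_congr_ae ?_
    filter_upwards [hhg] with x hx
    have : conv (mollifier n k) h x = conv (mollifier n k) g x :=
      integral_congr_ae (by filter_upwards [hhg] with y hy; rw [hy])
    rw [this, hx]
  have hloc : LocallyIntegrable h volume := hh.locallyIntegrable (by norm_num)
  have hη : ∀ k, Measurable fun y : Euc n => ENNReal.ofReal (mollifier n k y) := fun k =>
    (contDiff_mollifier k).continuous.measurable.ennreal_ofReal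
  have hm2 : Measurable fun p : Euc n × Euc n => ‖h (p.1 - p.2) - h p.1‖ₑ ^ 2 := by
    have := hm.measurable
    fun_prop
  have hm3 : ∀ k, AEMeasurable (Function.uncurry fun x y : Euc n =>
      ENNReal.ofReal (mollifier n k y) * ‖h (x - y) - h x‖ₑ ^ 2) (volume.prod volume) := fun k =>
    (((hη k).comp measurable_snd).mul hm2).aemeasurable
  -- Jensen's inequality, as comparison of the L¹ and L² norms for the probability measure
  -- `mollifierMeasure n k`.
  have key : ∀ k x, ‖conv (mollifier n k) h x - h x‖ₑ ^ 2 ≤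
      ∫⁻ y, ENNReal.ofReal (mollifier n k y) * ‖h (x - y) - h x‖ₑ ^ 2 := fun k x => by
    have hmx : Measurable fun y => h (x - y) - h x := by
      have := hm.measurable
      fun_prop
    have e1 : conv (mollifier n k) h x - h x = ∫ y, mollifier n k y * (h (x - y) - h x) := by
      have i1 : Integrable fun y => mollifier n k y * h (x - y) :=
        (hasCompactSupport_mollifier k).convolutionExists_left
          (ContinuousLinearMap.mul ℝ ℝ) (contDiff_mollifier k).continuous hloc x
      have i2 : Integrable fun y => mollifier n k y * h x :=
        ((contDiff_mollifier k).continuous.integrable_of_hasCompactSupport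
          (hasCompactSupport_mollifier k)).mul_const _
      simp only [mul_sub]
      rw [integral_sub i1 i2, integral_mul_const, integral_mollifier, conv_eq_integral_sub, one_mul]
    have e2 : ‖conv (mollifier n k) h x - h x‖ₑ ≤
        eLpNorm (fun y => h (x - y) - h x) 1 (mollifierMeasure n k) := by
      rw [e1, eLpNorm_one_eq_lintegral_enorm, mollifierMeasure,
        lintegral_withDensity_eq_lintegral_mul _ (hη k) hmx.enorm]
      refine (enorm_integral_le_lintegral_enorm _).trans (lintegral_mono fun y => ?_)
      simp only [Pi.mul_apply]
      rw [enorm_mul, Real.enorm_of_nonneg (mollifier_nonneg k y)]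
    have e3 : eLpNorm (fun y => h (x - y) - h x) 1 (mollifierMeasure n k) ≤
        eLpNorm (fun y => h (x - y) - h x) 2 (mollifierMeasure n k) :=
      eLpNorm_le_eLpNorm_of_exponent_le (by norm_num) hmx.aestronglyMeasurable
    refine (pow_le_pow_left' (e2.trans e3) 2).trans (le_of_eq ?_)
    rw [eLpNorm_eq_lintegral_rpow_enorm_toReal (by norm_num) (by norm_num)]
    simp only [ENNReal.toReal_ofNat]
    rw [← ENNReal.rpow_natCast, ← ENNReal.rpow_mul]
    norm_num
    rw [mollifierMeasure, lintegral_withDensity_eq_lintegral_mul _ (hη k) (hmx.enorm.pow_const 2)]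
    rfl
  have key2 : ∀ k, ∫⁻ x, ‖conv (mollifier n k) h x - h x‖ₑ ^ 2 ≤
      ∫⁻ y, ENNReal.ofReal (mollifier n k y) * ∫⁻ x, ‖h (x - y) - h x‖ₑ ^ 2 := fun k => by
    refine (lintegral_mono (key k)).trans (le_of_eq ?_)
    rw [lintegral_lintegral_swap]
    · refine lintegral_congr fun y => ?_
      have hy : Measurable fun x => ‖h (x - y) - h x‖ₑ ^ 2 := by
        have := hm.measurable
        fun_prop
      exact lintegral_const_mul _ hy
    · exact hm3 k
  rw [ENNReal.tendsto_atTop_zero]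
  intro ε hε
  have hT := continuous_translation_Lp hh
  rw [ENNReal.tendsto_nhds_zero] at hT
  obtain ⟨δ, hδ, hball⟩ := Metric.eventually_nhds_iff.1 (hT ε hε)
  obtain ⟨N, hN⟩ := exists_nat_one_div_lt hδ
  refine ⟨N, fun k hk => (key2 k).trans ?_⟩
  calc _ ≤ ∫⁻ y, ENNReal.ofReal (mollifier n k y) * ε := by
        refine lintegral_mono fun y => ?_
        by_cases hy : ‖y‖ < δ
        · gcongr
          exact hball (by simpa using hy)
        · rw [mollifier_eq_zero]
          · simp
          · refine le_trans ?_ (not_lt.1 hy)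
            refine le_trans ?_ hN.le
            gcongr
    _ = ε := by
        rw [lintegral_mul_const _ (hη k)]
        have := measure_univ (μ := mollifierMeasure n k)
        rw [mollifierMeasure, withDensity_apply _ MeasurableSet.univ, setLIntegral_univ] at this
        rw [this, one_mul]

end Mollification

/-! ### Essential self-adjointness: the range of the weighted Laplacian -/

section Tools

open Filter Topology

lemma integral_mul_sq_le {α : Type*} [MeasurableSpace α] {μ : Measure α} {a b : α → ℝ}
    (ha : MemLp a 2 μ) (hb : MemLp b 2 μ) :
    (∫ x, a x * b x ∂μ) ^ 2 ≤ (∫ x, a x ^ 2 ∂μ) * ∫ x, b x ^ 2 ∂μ := by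
  have h := integral_mul_norm_le_Lp_mul_Lq (μ := μ) (f := a) (g := b)
    (Real.HolderConjugate.two_two) (by simpa using ha) (by simpa using hb)
  have h1 : |∫ x, a x * b x ∂μ| ≤ ∫ x, ‖a x‖ * ‖b x‖ ∂μ := by
    simpa only [Real.norm_eq_abs, abs_mul] using
      abs_integral_le_integral_abs (f := fun x => a x * b x) (μ := μ)
  have h2 : |∫ x, a x * b x ∂μ| ≤
      √(∫ x, a x ^ 2 ∂μ) * √(∫ x, b x ^ 2 ∂μ) := by
    refine h1.trans (h.trans (le_of_eq ?_))
    simp [Real.sqrt_eq_rpow]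
  have h3 := pow_le_pow_left₀ (abs_nonneg _) h2 2
  rwa [sq_abs, mul_pow, Real.sq_sqrt (integral_nonneg fun x => sq_nonneg _),
    Real.sq_sqrt (integral_nonneg fun x => sq_nonneg _)] at h3

variable {n : ℕ}

lemma MeasureTheory.LocallyIntegrable.integrable_mul_of_hasCompactSupport {w h : Euc n → ℝ}
    (hh : LocallyIntegrable h volume) (hw : Continuous w) (hc : HasCompactSupport w) :
    Integrable (fun x => h x * w x) volume := by
  simpa only [smul_eq_mul, mul_comm] using hh.integrable_smul_left_of_hasCompactSupport hw hc

lemma eventually_memLp_conv_sub {h : Euc n → ℝ} (hh : MemLp h 2 volume) :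
    ∀ᶠ k in atTop, MemLp (fun x => conv (mollifier n k) h x - h x) 2 volume := by
  filter_upwards [(tendsto_lintegral_conv_mollifier_sub hh).eventually_lt_const one_pos]
    with k hk
  have hm : AEStronglyMeasurable (fun x => conv (mollifier n k) h x - h x) volume :=
    ((contDiff_mollifier k).conv (hasCompactSupport_mollifier k)
      (hh.locallyIntegrable (by norm_num))).continuous.aestronglyMeasurable.sub hh.1
  refine ⟨hm, ?_⟩
  rw [eLpNorm_lt_top_iff_lintegral_rpow_enorm_lt_top (by norm_num) (by norm_num)]
  simpa using hk.trans ENNReal.one_lt_top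

lemma tendsto_integral_conv_sub_sq {h : Euc n → ℝ} (hh : MemLp h 2 volume) :
    Tendsto (fun k => ∫ x, (conv (mollifier n k) h x - h x) ^ 2) atTop (𝓝 0) := by
  have h0 := (ENNReal.tendsto_toReal ENNReal.zero_ne_top).comp
    (tendsto_lintegral_conv_mollifier_sub hh)
  simp only [ENNReal.toReal_zero] at h0
  refine h0.congr fun k => ?_
  have hm : AEStronglyMeasurable (fun x => conv (mollifier n k) h x - h x) volume :=
    ((contDiff_mollifier k).conv (hasCompactSupport_mollifier k)
      (hh.locallyIntegrable (by norm_num))).continuous.aestronglyMeasurable.sub hh.1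
  rw [integral_eq_lintegral_of_nonneg_ae (Eventually.of_forall fun x => sq_nonneg _) (hm.pow 2)]
  simp only [Function.comp_apply]
  congr 1
  refine lintegral_congr fun x => ?_
  rw [← ofReal_norm, ← ENNReal.ofReal_pow (norm_nonneg _), Real.norm_eq_abs, sq_abs]

/-- A locally integrable function with vanishing weak gradient is almost everywhere constant. -/
lemma ae_eq_const_of_weak_gradient_eq_zero {v : Euc n → ℝ} (hv : LocallyIntegrable v volume)
    (h : ∀ φ : Euc n → ℝ, ContDiff ℝ ∞ φ → HasCompactSupport φ → ∀ i, ∫ x, v x * pd i φ x = 0) :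
    ∃ c, ∀ᵐ x, v x = c := by
  -- Testing the hypothesis with `y ↦ mollifier n k (x - y)` shows that each mollification has zero
  -- gradient. The constants then converge to `v` almost everywhere.
  have hconst : ∀ k x y, conv (mollifier n k) v x = conv (mollifier n k) v y := by
    intro k
    have hd := (contDiff_mollifier k).conv (hasCompactSupport_mollifier k) hv
    refine is_const_of_fderiv_eq_zero (𝕜 := ℝ) (hd.differentiable (by norm_num)) fun x => ?_
    have hpd : ∀ i, pd i (conv (mollifier n k) v) x = 0 := fun i => by
      rw [pd_conv (contDiff_mollifier k) (hasCompactSupport_mollifier k) hv]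
      have hφ : ContDiff ℝ ∞ fun y => mollifier n k (x - y) :=
        (contDiff_mollifier k).comp (contDiff_const.sub contDiff_id)
      have hφc : HasCompactSupport fun y => mollifier n k (x - y) :=
        (hasCompactSupport_mollifier k).comp_homeomorph (Homeomorph.subLeft x)
      have e := h _ hφ hφc i
      simp only [pd_comp_const_sub (contDiff_mollifier k), mul_neg, integral_neg, neg_eq_zero] at e
      rw [conv, ← e]
      simp only [mul_comm]
    apply ContinuousLinearMap.coe_injective
    refine (EuclideanSpace.basisFun (Fin n) ℝ).toBasis.ext fun i => ?_
    simpa [pd] using hpd i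
  have hae := ae_tendsto_conv_mollifier hv
  obtain ⟨x₀, hx₀⟩ := hae.exists
  refine ⟨v x₀, ?_⟩
  filter_upwards [hae] with x hx
  exact tendsto_nhds_unique (hx.congr fun k => hconst k x x₀) hx₀

end Tools

/-! ### Ground state transform and Caccioppoli's inequality -/

section Schrodinger

open Filter Topology

variable {n : ℕ} {ψ : Euc n → ℝ}

/-- The Laplacian. -/
noncomputable def lap (f : Euc n → ℝ) : Euc n → ℝ := fun x => ∑ i, pd i (pd i f) x

/-- The potential `|∇ψ|²/4 - Δψ/2` of the Schrödinger operator conjugate to `gen ψ`. -/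
noncomputable def pot (ψ : Euc n → ℝ) : Euc n → ℝ :=
  fun x => ∑ i, (pd i ψ x ^ 2 / 4 - pd i (pd i ψ) x / 2)

lemma ContDiff.lap {f : Euc n → ℝ} (hf : ContDiff ℝ ∞ f) : ContDiff ℝ ∞ (lap f) :=
  ContDiff.sum fun i _ => (hf.pd i).pd i

lemma HasCompactSupport.lap {f : Euc n → ℝ} (hf : HasCompactSupport f) :
    HasCompactSupport (lap f) := by
  refine hf.mono' fun x hx => ?_
  contrapose! hx
  have h2 : ∀ i, _root_.pd i (_root_.pd i f) x = 0 := fun i =>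
    image_eq_zero_of_notMem_tsupport fun h => hx
      (tsupport_fderiv_apply_subset ℝ _ (tsupport_fderiv_apply_subset ℝ _ h))
  simp [_root_.lap, h2]

lemma ContDiff.pot (hψ : ContDiff ℝ ∞ ψ) : ContDiff ℝ ∞ (pot ψ) :=
  ContDiff.sum fun i _ => (((hψ.pd i).pow 2).div_const 4).sub (((hψ.pd i).pd i).div_const 2)

lemma contDiff_exp_half (hψ : ContDiff ℝ ∞ ψ) : ContDiff ℝ ∞ fun x => Real.exp (ψ x / 2) :=
  (hψ.div_const 2).exp

lemma pd_div_const {f : Euc n → ℝ} {x : Euc n} (hf : DifferentiableAt ℝ f x) (i : Fin n) (c : ℝ) :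
    pd i (fun y => f y / c) x = pd i f x / c := by
  simp only [pd, div_eq_mul_inv]
  rw [fderiv_mul_const hf]
  simp [mul_comm]

lemma pd_exp_half_mul (hψ : ContDiff ℝ ∞ ψ) {φ : Euc n → ℝ} (hφ : ContDiff ℝ ∞ φ) (i : Fin n) :
    pd i (fun y => Real.exp (ψ y / 2) * φ y) =
      fun y => Real.exp (ψ y / 2) * (pd i φ y + pd i ψ y / 2 * φ y) := by
  ext x
  have d : ∀ {f : Euc n → ℝ}, ContDiff ℝ ∞ f → DifferentiableAt ℝ f x := fun hf =>
    hf.differentiable (by norm_num) x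
  have h2 : pd i (fun y => ψ y / 2) x = pd i ψ x / 2 := pd_div_const (d hψ) i 2
  rw [pd_mul (d (contDiff_exp_half hψ)) (d hφ), pd_exp (d (hψ.div_const 2)), h2]
  ring

/-- The ground state transform conjugates `gen ψ` to a Schrödinger operator. -/
lemma gen_exp_half_mul (hψ : ContDiff ℝ ∞ ψ) {φ : Euc n → ℝ} (hφ : ContDiff ℝ ∞ φ) (x : Euc n) :
    gen ψ (fun y => Real.exp (ψ y / 2) * φ y) x =
      Real.exp (ψ x / 2) * (lap φ x - pot ψ x * φ x) := by
  have d : ∀ {f : Euc n → ℝ}, ContDiff ℝ ∞ f → DifferentiableAt ℝ f x := fun hf =>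
    hf.differentiable (by norm_num) x
  simp only [gen, lap, pot]
  rw [Finset.sum_mul, ← Finset.sum_sub_distrib, Finset.mul_sum]
  refine Finset.sum_congr rfl fun i _ => ?_
  have h2 : pd i (fun y => pd i ψ y / 2 * φ y) x =
      pd i ψ x / 2 * pd i φ x + φ x * (pd i (pd i ψ) x / 2) := by
    rw [pd_mul (d ((hψ.pd i).div_const 2)) (d hφ), pd_div_const (d (hψ.pd i)) i 2]
  have h3 : pd i (fun y => pd i φ y + pd i ψ y / 2 * φ y) x =
      pd i (pd i φ) x + pd i (fun y => pd i ψ y / 2 * φ y) x := by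
    simp only [pd]
    rw [fderiv_fun_add]
    · rfl
    · exact d (hφ.pd i)
    · exact d (((hψ.pd i).div_const 2).mul hφ)
  rw [pd_exp_half_mul hψ hφ i,
    pd_exp_half_mul hψ ((hφ.pd i).add (((hψ.pd i).div_const 2).mul hφ))]
  beta_reduce
  rw [h3, h2]
  ring

/-- Caccioppoli's inequality for the weighted Laplacian. -/
lemma caccioppoli [IsFiniteMeasure (weighted ψ)] (hψ : ContDiff ℝ ∞ ψ) {g χ : Euc n → ℝ}
    (hg : ContDiff ℝ ∞ g) (hχ : ContDiff ℝ ∞ χ) (hc : HasCompactSupport χ) :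
    ∫ x, χ x ^ 2 * ∑ i, pd i (fun y => Real.exp (ψ y / 2) * g y) x ^ 2 ∂(weighted ψ) ≤
      2 * (∫ x, |χ x ^ 2 * (g x * (lap g x - pot ψ x * g x))|) +
        4 * ∫ x, (∑ i, pd i χ x ^ 2) * g x ^ 2 := by
  set v : Euc n → ℝ := fun y => Real.exp (ψ y / 2) * g y with hv
  have hvs : ContDiff ℝ ∞ v := (contDiff_exp_half hψ).mul hg
  have hχ2 : ContDiff ℝ ∞ fun x => χ x ^ 2 * v x := (hχ.pow 2).mul hvs
  have hc2 : HasCompactSupport fun x => χ x ^ 2 := by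
    simp only [sq]
    exact hc.mul_right
  have hc2' : HasCompactSupport fun x => χ x ^ 2 * v x := hc2.mul_right
  -- Testing against `χ² v`: the compact support comes from `χ`, so `v` needs no integrability.
  have green := integral_gen_mul hψ hvs (hχ2.of_le (by norm_num : (1 : WithTop ℕ∞) ≤ ∞))
    (Or.inr hc2')
  have d : ∀ {f : Euc n → ℝ}, ContDiff ℝ ∞ f → ∀ x, DifferentiableAt ℝ f x := fun hf x =>
    hf.differentiable (by norm_num) x
  have hpd : ∀ i x, pd i (fun x => χ x ^ 2 * v x) x =
      χ x ^ 2 * pd i v x + v x * (2 * χ x * pd i χ x) := fun i x => by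
    rw [pd_mul (d (hχ.pow 2) x) (d hvs x)]
    simp only [sq]
    rw [pd_mul (d hχ x) (d hχ x)]
    ring
  have ee : ∀ x, Real.exp (ψ x / 2) * Real.exp (ψ x / 2) * Real.exp (-ψ x) = 1 := fun x => by
    rw [← Real.exp_add, ← Real.exp_add]
    simp
  have e1 : ∫ x, |χ x ^ 2 * (g x * (lap g x - pot ψ x * g x))| =
      ∫ x, |gen ψ v x * (χ x ^ 2 * v x)| ∂(weighted ψ) := by
    rw [integral_weighted hψ.continuous]
    refine integral_congr_ae (Eventually.of_forall fun x => ?_)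
    simp only [hv]
    rw [gen_exp_half_mul hψ hg]
    conv_rhs => rw [← abs_of_pos (Real.exp_pos (-ψ x)), ← abs_mul]
    congr 1
    linear_combination (-χ x ^ 2 * (g x * (lap g x - pot ψ x * g x))) * ee x
  have e2 : ∫ x, (∑ i, pd i χ x ^ 2) * g x ^ 2 =
      ∫ x, (∑ i, pd i χ x ^ 2) * v x ^ 2 ∂(weighted ψ) := by
    rw [integral_weighted hψ.continuous]
    refine integral_congr_ae (Eventually.of_forall fun x => ?_)
    simp only [hv]
    linear_combination (-(∑ i, pd i χ x ^ 2) * g x ^ 2) * ee x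
  rw [e1, e2]
  have c1 : Continuous fun x => χ x ^ 2 * ∑ i, pd i v x ^ 2 :=
    (hχ.continuous.pow 2).mul (continuous_finsetSum _ fun i _ => (hvs.pd i).continuous.pow 2)
  have i1 : Integrable (fun x => χ x ^ 2 * ∑ i, pd i v x ^ 2) (weighted ψ) :=
    c1.integrable_of_hasCompactSupport hc2.mul_right
  have i2 : Integrable (fun x => gen ψ v x * (χ x ^ 2 * v x)) (weighted ψ) :=
    ((hψ.gen hvs).continuous.mul hχ2.continuous).integrable_of_hasCompactSupport hc2'.mul_left
  have i3 : Integrable (fun x => (∑ i, pd i χ x ^ 2) * v x ^ 2) (weighted ψ) := by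
    simp only [Finset.sum_mul]
    refine integrable_finsetSum _ fun i _ => ?_
    refine (((hχ.pd i).continuous.pow 2).mul
      (hvs.continuous.pow 2)).integrable_of_hasCompactSupport (HasCompactSupport.mul_right ?_)
    simp only [sq]
    exact (hc.pd i).mul_right
  have i4 : Integrable (fun x => ∑ i, pd i v x * pd i (fun x => χ x ^ 2 * v x) x) (weighted ψ) :=
    integrable_finsetSum _ fun i _ => ((hvs.pd i).continuous.mul
      (hχ2.pd i).continuous).integrable_of_hasCompactSupport (hc2'.pd i).mul_left
  -- In each summand, right side minus left side is exactly `(χ ∂ᵢv + 2 v ∂ᵢχ)²`.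
  have p : ∀ x, χ x ^ 2 * ∑ i, pd i v x ^ 2 ≤
      2 * (∑ i, pd i v x * pd i (fun x => χ x ^ 2 * v x) x) +
        4 * ((∑ i, pd i χ x ^ 2) * v x ^ 2) := fun x => by
    rw [Finset.mul_sum, Finset.mul_sum, Finset.sum_mul, Finset.mul_sum, ← Finset.sum_add_distrib]
    refine Finset.sum_le_sum fun i _ => ?_
    rw [hpd]
    nlinarith [sq_nonneg (χ x * pd i v x + 2 * (v x * pd i χ x))]
  have q := integral_mono i1 ((i4.const_mul 2).add (i3.const_mul 4)) p
  simp only [Pi.add_apply] at q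
  rw [integral_add (i4.const_mul 2) (i3.const_mul 4), integral_const_mul, integral_const_mul,
    ← neg_eq_iff_eq_neg.2 green] at q
  have r : -∫ x, gen ψ v x * (χ x ^ 2 * v x) ∂(weighted ψ) ≤
      ∫ x, |gen ψ v x * (χ x ^ 2 * v x)| ∂(weighted ψ) :=
    (neg_le_abs _).trans abs_integral_le_integral_abs
  linarith

end Schrodinger

/-! ### Orthogonality to the range of the weighted Laplacian forces constancy -/

section Range

open Filter Topology

variable {n : ℕ} {ψ : Euc n → ℝ}

/-- Mollification of a distributional solution of `Δh = W h`. -/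
lemma lap_conv_mollifier {h W : Euc n → ℝ} (hh : LocallyIntegrable h volume) (hW : Continuous W)
    (hweak : ∀ φ : Euc n → ℝ, ContDiff ℝ ∞ φ → HasCompactSupport φ →
      ∫ x, h x * (lap φ x - W x * φ x) = 0) (k : ℕ) (x : Euc n) :
    lap (conv (mollifier n k) h) x = conv (mollifier n k) (fun y => W y * h y) x := by
  have hη := contDiff_mollifier (n := n) k
  have hηc := hasCompactSupport_mollifier (n := n) k
  have hφ : ContDiff ℝ ∞ fun y => mollifier n k (x - y) := hη.comp (contDiff_const.sub contDiff_id)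
  have hφc : HasCompactSupport fun y => mollifier n k (x - y) :=
    hηc.comp_homeomorph (Homeomorph.subLeft x)
  -- The reflected, translated mollifier is itself a test function, so the weak equation at this
  -- function is the mollified equation at `x`.
  have e := hweak _ hφ hφc
  have hlap : ∀ y, lap (fun y => mollifier n k (x - y)) y = lap (mollifier n k) (x - y) := by
    intro y
    refine Finset.sum_congr rfl fun i _ => ?_
    rw [pd_comp_const_sub hη, pd_neg, pd_comp_const_sub (hη.pd i)]
    simp
  have i1 := hh.integrable_mul_of_hasCompactSupport hφ.lap.continuous hφc.lap
  have i2 := hh.integrable_mul_of_hasCompactSupport (hW.mul hφ.continuous) hφc.mul_left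
  simp only [mul_sub] at e
  rw [integral_sub i1 (by simpa using i2), sub_eq_zero] at e
  have i3 : ∀ i, Integrable fun y => pd i (pd i (mollifier n k)) (x - y) * h y := fun i => by
    have := hh.integrable_mul_of_hasCompactSupport (w := fun y => pd i (pd i (mollifier n k)) (x - y))
      (((hη.pd i).pd i).continuous.comp (by fun_prop))
      (((hηc.pd i).pd i).comp_homeomorph (Homeomorph.subLeft x))
    simpa only [mul_comm] using this
  calc lap (conv (mollifier n k) h) x = ∑ i, conv (pd i (pd i (mollifier n k))) h x := by
        refine Finset.sum_congr rfl fun i _ => ?_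
        rw [pd_conv hη hηc hh, pd_conv (hη.pd i) (hηc.pd i) hh]
    _ = ∫ y, h y * lap (mollifier n k) (x - y) := by
        simp only [conv]
        rw [← integral_finsetSum _ fun i _ => i3 i]
        refine integral_congr_ae (Eventually.of_forall fun y => ?_)
        simp only [lap]
        rw [← Finset.sum_mul, mul_comm]
    _ = conv (mollifier n k) (fun y => W y * h y) x := by
        simp only [hlap] at e
        rw [e, conv]
        refine integral_congr_ae (Eventually.of_forall fun y => ?_)
        simp only
        ring

lemma integral_add_sq_le {α : Type*} [MeasurableSpace α] {μ : Measure α} {a b : α → ℝ}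
    (ha : MemLp a 2 μ) (hb : MemLp b 2 μ) :
    ∫ x, (a x + b x) ^ 2 ∂μ ≤ 2 * ∫ x, a x ^ 2 ∂μ + 2 * ∫ x, b x ^ 2 ∂μ := by
  rw [← integral_const_mul, ← integral_const_mul,
    ← integral_add (ha.integrable_sq.const_mul 2) (hb.integrable_sq.const_mul 2)]
  refine integral_mono (ha.add hb).integrable_sq
    ((ha.integrable_sq.const_mul 2).add (hb.integrable_sq.const_mul 2)) fun x => ?_
  simp only
  nlinarith [sq_nonneg (a x - b x)]

/-- The error made by mollifying a distributional solution of `Δh = W h` vanishes locally. -/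
lemma tendsto_integral_mollified_error {h W χ : Euc n → ℝ} (hh : MemLp h 2 volume)
    (hW : Continuous W)
    (hweak : ∀ φ : Euc n → ℝ, ContDiff ℝ ∞ φ → HasCompactSupport φ →
      ∫ x, h x * (lap φ x - W x * φ x) = 0)
    (hχ0 : ∀ x, 0 ≤ χ x) (hχ1 : ∀ x, χ x ≤ 1) (hc : HasCompactSupport χ) :
    Tendsto (fun k => ∫ x, |χ x ^ 2 * (conv (mollifier n k) h x *
      (lap (conv (mollifier n k) h) x - W x * conv (mollifier n k) h x))|) atTop (𝓝 0) := by
  have hloc : LocallyIntegrable h volume := hh.locallyIntegrable (by norm_num)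
  obtain ⟨R, hR⟩ : ∃ R, tsupport χ ⊆ Metric.closedBall 0 R :=
    hc.isCompact.isBounded.subset_closedBall 0
  obtain ⟨M, hM⟩ := (isCompact_closedBall (0 : Euc n) (R + 1)).exists_bound_of_continuousOn
    hW.continuousOn
  have hM0 : ∀ x ∈ Metric.closedBall (0 : Euc n) (R + 1), ‖W x‖ ≤ |M| := fun x hx =>
    (hM x hx).trans (le_abs_self M)
  -- `W` may be unbounded, so `W h` need not be in L². Truncating at radius `R + 1` changes nothing
  -- where `χ` lives, since every mollifier is supported within distance 1 of the origin.
  set K : Euc n → ℝ := (Metric.closedBall (0 : Euc n) (R + 1)).indicator fun x => W x * h x with hK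
  have hKm : MemLp K 2 volume := by
    refine (hh.const_mul |M|).mono ((hW.aestronglyMeasurable.mul hh.1).indicator
      measurableSet_closedBall) (Eventually.of_forall fun x => ?_)
    rw [hK, norm_indicator_eq_indicator_norm]
    by_cases hx : x ∈ Metric.closedBall (0 : Euc n) (R + 1)
    · rw [Set.indicator_of_mem hx, norm_mul, norm_mul]
      have := hM0 x hx
      simp only [Real.norm_eq_abs, abs_abs] at this ⊢
      gcongr
    · rw [Set.indicator_of_notMem hx]
      exact norm_nonneg _
  have ha := tendsto_integral_conv_sub_sq hh
  have hb := tendsto_integral_conv_sub_sq hKm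
  set a : ℕ → ℝ := fun k => ∫ x, (conv (mollifier n k) h x - h x) ^ 2
  set b : ℕ → ℝ := fun k => ∫ x, (conv (mollifier n k) K x - K x) ^ 2
  have hlim : Tendsto (fun k => √((2 * ∫ x, h x ^ 2) + 2 * a k) *
      √(2 * b k + 2 * (M ^ 2 * a k))) atTop (𝓝 0) := by
    have h1 : Tendsto (fun k => √((2 * ∫ x, h x ^ 2) + 2 * a k)) atTop
        (𝓝 √((2 * ∫ x, h x ^ 2) + 2 * 0)) := (tendsto_const_nhds.add (ha.const_mul 2)).sqrt
    have h2 : Tendsto (fun k => √(2 * b k + 2 * (M ^ 2 * a k))) atTop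
        (𝓝 √(2 * 0 + 2 * (M ^ 2 * 0))) :=
      ((hb.const_mul 2).add ((ha.const_mul (M ^ 2)).const_mul 2)).sqrt
    simpa using h1.mul h2
  refine tendsto_of_tendsto_of_tendsto_of_le_of_le' tendsto_const_nhds hlim
    (Eventually.of_forall fun k => integral_nonneg fun x => abs_nonneg _) ?_
  filter_upwards [eventually_memLp_conv_sub hh, eventually_memLp_conv_sub hKm] with k hek hdk
  set e : Euc n → ℝ := fun x => conv (mollifier n k) h x - h x with he
  set d : Euc n → ℝ := fun x => conv (mollifier n k) K x - K x with hd
  have hek' : MemLp (fun x => |e x|) 2 volume := hek.norm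
  have hdk' : MemLp (fun x => |d x|) 2 volume := hdk.norm
  have hh' : MemLp (fun x => |h x|) 2 volume := hh.norm
  have hMe : MemLp (fun x => |M| * |e x|) 2 volume := hek'.const_mul _
  have hA : MemLp (fun x => |h x| + |e x|) 2 volume := hh'.add hek'
  have hB : MemLp (fun x => |d x| + |M| * |e x|) 2 volume := hdk'.add hMe
  have pt : ∀ x, |χ x ^ 2 * (conv (mollifier n k) h x *
      (lap (conv (mollifier n k) h) x - W x * conv (mollifier n k) h x))| ≤
      (|h x| + |e x|) * (|d x| + |M| * |e x|) := by
    intro x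
    by_cases hx : χ x = 0
    · rw [hx]
      simp only [ne_eq, OfNat.ofNat_ne_zero, not_false_eq_true, zero_pow, zero_mul, abs_zero]
      positivity
    have hxR : ‖x‖ ≤ R := by
      simpa using hR (subset_tsupport _ hx)
    have hxB : x ∈ Metric.closedBall (0 : Euc n) (R + 1) := by
      simpa using hxR.trans (by linarith)
    have hKx : K x = W x * h x := by rw [hK, Set.indicator_of_mem hxB]
    have hcK : conv (mollifier n k) (fun y => W y * h y) x = conv (mollifier n k) K x := by
      refine integral_congr_ae (Eventually.of_forall fun y => ?_)
      simp only [hK]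
      by_cases hy : y ∈ Metric.closedBall (0 : Euc n) (R + 1)
      · rw [Set.indicator_of_mem hy]
      · rw [Set.indicator_of_notMem hy, mollifier_eq_zero, zero_mul, zero_mul]
        simp only [Metric.mem_closedBall, dist_zero_right, not_le] at hy
        have h1 : ‖y‖ - ‖x‖ ≤ ‖x - y‖ := by
          rw [norm_sub_rev]
          exact norm_sub_norm_le y x
        have h2 : 1 / ((k : ℝ) + 1) ≤ 1 := by
          rw [div_le_one (by positivity)]
          linarith [(Nat.cast_nonneg k : (0 : ℝ) ≤ k)]
        linarith
    -- The equation replaces the Laplacian by a mollification of `K`, so the residual consists of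
    -- two L² mollification errors and contains no derivative of `e`.
    have hs : lap (conv (mollifier n k) h) x - W x * conv (mollifier n k) h x =
        d x - W x * e x := by
      rw [lap_conv_mollifier hloc hW hweak, hcK, hd, he]
      simp only [hKx]
      ring
    have hg : conv (mollifier n k) h x = h x + e x := by simp [he]
    rw [hs, hg, abs_mul, abs_mul, abs_of_nonneg (sq_nonneg _)]
    have hχ2 : χ x ^ 2 ≤ 1 := pow_le_one₀ (hχ0 x) (hχ1 x)
    calc χ x ^ 2 * (|h x + e x| * |d x - W x * e x|) ≤ 1 * (|h x + e x| * |d x - W x * e x|) := by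
          gcongr
      _ ≤ (|h x| + |e x|) * (|d x| + |M| * |e x|) := by
          rw [one_mul]
          gcongr
          · exact abs_add_le _ _
          · refine (abs_sub _ _).trans ?_
            rw [abs_mul]
            exact add_le_add le_rfl (mul_le_mul_of_nonneg_right (hM0 x hxB) (abs_nonneg _))
  calc _ ≤ ∫ x, (|h x| + |e x|) * (|d x| + |M| * |e x|) :=
        integral_mono_of_nonneg (Eventually.of_forall fun x => abs_nonneg _)
          (hA.integrable_mul hB) (Eventually.of_forall pt)
    _ ≤ √(∫ x, (|h x| + |e x|) ^ 2) * √(∫ x, (|d x| + |M| * |e x|) ^ 2) := by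
        rw [← Real.sqrt_mul (integral_nonneg fun x => sq_nonneg _)]
        exact Real.le_sqrt_of_sq_le (integral_mul_sq_le hA hB)
    _ ≤ _ := by
        have h1 := integral_add_sq_le hh' hek'
        have h2 := integral_add_sq_le hdk' hMe
        simp only [mul_pow, sq_abs, integral_const_mul] at h1 h2
        gcongr

/-- Smooth cutoff functions with gradients of order `1 / R`. -/
lemma exists_cutoff (n : ℕ) : ∃ C : ℝ, 0 ≤ C ∧ ∀ R : ℝ, 0 < R → ∃ χ : Euc n → ℝ,
    ContDiff ℝ ∞ χ ∧ HasCompactSupport χ ∧ (∀ x, 0 ≤ χ x) ∧ (∀ x, χ x ≤ 1) ∧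
      (∀ x, ‖x‖ ≤ R → χ x = 1) ∧ ∀ x, ∑ i, pd i χ x ^ 2 ≤ C / R ^ 2 := by
  -- One fixed bump is dilated by `R`; each derivative yields a factor `R⁻¹`, so the constant does
  -- not depend on `R`.
  let f : ContDiffBump (0 : Euc n) := ⟨1, 2, by norm_num, by norm_num⟩
  have hf : ContDiff ℝ ∞ f := f.contDiff
  have hcont : Continuous fun x => ∑ i, pd i f x ^ 2 :=
    continuous_finsetSum _ fun i _ => (hf.pd i).continuous.pow 2
  have hcs : HasCompactSupport fun x => ∑ i, pd i f x ^ 2 := by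
    refine f.hasCompactSupport.mono' fun x hx => ?_
    contrapose! hx
    have h1 : ∀ i, pd i f x = 0 := fun i =>
      image_eq_zero_of_notMem_tsupport fun h => hx (tsupport_fderiv_apply_subset ℝ _ h)
    simp [h1]
  obtain ⟨C, hC⟩ := hcont.bounded_above_of_compact_support hcs
  refine ⟨|C|, abs_nonneg _, fun R hR => ⟨fun x => f (R⁻¹ • x), hf.comp (contDiff_const_smul _),
    f.hasCompactSupport.comp_smul (inv_ne_zero hR.ne'), fun x => f.nonneg, fun x => f.le_one,
    fun x hx => ?_, fun x => ?_⟩⟩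
  · apply f.one_of_mem_closedBall
    rw [mem_closedBall_zero_iff, norm_smul, norm_inv, Real.norm_of_nonneg hR.le]
    change R⁻¹ * ‖x‖ ≤ 1
    rw [inv_mul_le_iff₀ hR]
    simpa using hx
  · have e : ∀ i, pd i (fun x => f (R⁻¹ • x)) x = R⁻¹ * pd i f (R⁻¹ • x) := fun i => by
      have hd : HasFDerivAt (fun y => f (R⁻¹ • y)) ((fderiv ℝ f (R⁻¹ • x)).comp
          (R⁻¹ • ContinuousLinearMap.id ℝ (Euc n))) x :=
        HasFDerivAt.comp (g := f) x (hf.differentiable (by norm_num) (R⁻¹ • x)).hasFDerivAt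
          ((hasFDerivAt_id x).const_smul R⁻¹)
      simp only [pd]
      rw [hd.fderiv]
      simp
    simp only [e, mul_pow, ← Finset.mul_sum]
    have := (Real.le_norm_self _).trans ((hC (R⁻¹ • x)).trans (le_abs_self C))
    rw [div_eq_mul_inv, inv_pow, mul_comm]
    gcongr

/-- A function in `L²(e^{-ψ})` orthogonal to the range of the weighted Laplacian on test functions
is constant. -/
theorem ae_eq_const_of_orthogonal_gen [IsFiniteMeasure (weighted ψ)] (hψ : ContDiff ℝ ∞ ψ)
    {v : Euc n → ℝ} (hv : MemLp v 2 (weighted ψ))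
    (horth : ∀ u : Euc n → ℝ, ContDiff ℝ ∞ u → HasCompactSupport u →
      ∫ x, v x * gen ψ u x ∂(weighted ψ) = 0) : ∃ c, ∀ᵐ x ∂(weighted ψ), v x = c := by
  have hac : volume ≪ weighted ψ := by
    have := hψ.continuous
    exact withDensity_absolutelyContinuous' (by fun_prop)
      (Eventually.of_forall fun x => by simp [Real.exp_pos])
  -- The ground state transform is an isometry from L²(e^{-ψ}) to L²(dx), where mollification works.
  set h : Euc n → ℝ := fun x => Real.exp (-ψ x / 2) * v x with hh
  have hcq : Continuous fun x => Real.exp (-ψ x / 2) :=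
    Real.continuous_exp.comp (hψ.continuous.neg.div_const 2)
  have hcp : Continuous fun x => Real.exp (ψ x / 2) := (contDiff_exp_half hψ).continuous
  have hvm : AEStronglyMeasurable v volume := hv.1.mono_ac hac
  have hhL : MemLp h 2 volume := by
    have hm : AEStronglyMeasurable h volume := hcq.aestronglyMeasurable.mul hvm
    rw [memLp_two_iff_integrable_sq hm]
    have := (integrable_weighted_iff hψ.continuous).1 hv.integrable_sq
    refine this.congr (Eventually.of_forall fun x => ?_)
    simp only [hh, mul_pow, ← Real.exp_nat_mul]
    rw [mul_comm]
    congr 2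
    push_cast
    ring
  have hloc : LocallyIntegrable h volume := hhL.locallyIntegrable (by norm_num)
  have hvh : v = fun x => Real.exp (ψ x / 2) * h x := by
    ext x
    simp only [hh, ← mul_assoc, ← Real.exp_add]
    ring_nf
    simp
  have hvloc : LocallyIntegrable v volume := by
    rw [hvh]
    exact hloc.continuous_mul hcp
  -- Orthogonality tested with `u = e^{ψ/2} φ`.
  have hweak : ∀ φ : Euc n → ℝ, ContDiff ℝ ∞ φ → HasCompactSupport φ →
      ∫ x, h x * (lap φ x - pot ψ x * φ x) = 0 := by
    intro φ hφ hφc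
    rw [← horth _ ((contDiff_exp_half hψ).mul hφ) hφc.mul_left, integral_weighted hψ.continuous]
    refine integral_congr_ae (Eventually.of_forall fun x => ?_)
    simp only [gen_exp_half_mul hψ hφ, hh]
    have : Real.exp (-ψ x / 2) = Real.exp (ψ x / 2) * Real.exp (-ψ x) := by
      rw [← Real.exp_add]
      ring_nf
    rw [this]
    ring
  suffices hgrad : ∀ φ : Euc n → ℝ, ContDiff ℝ ∞ φ → HasCompactSupport φ →
      ∀ i, ∫ x, v x * pd i φ x = 0 by
    obtain ⟨c, hc⟩ := ae_eq_const_of_weak_gradient_eq_zero hvloc hgrad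
    exact ⟨c, (withDensity_absolutelyContinuous _ _).ae_le hc⟩
  intro φ hφ hφc i
  obtain ⟨C, hC0, hC⟩ := exists_cutoff n
  obtain ⟨R₀, hR₀⟩ : ∃ R, tsupport φ ⊆ Metric.closedBall 0 R :=
    hφc.isCompact.isBounded.subset_closedBall 0
  set g : ℕ → Euc n → ℝ := fun k => conv (mollifier n k) h with hg
  have hgs : ∀ k, ContDiff ℝ ∞ (g k) := fun k =>
    (contDiff_mollifier k).conv (hasCompactSupport_mollifier k) hloc
  set w : ℕ → Euc n → ℝ := fun k y => Real.exp (ψ y / 2) * g k y with hw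
  have hws : ∀ k, ContDiff ℝ ∞ (w k) := fun k => (contDiff_exp_half hψ).mul (hgs k)
  have ha := tendsto_integral_conv_sub_sq hhL
  have hee := eventually_memLp_conv_sub hhL
  have hpair : Tendsto (fun k => ∫ x, w k x * pd i φ x) atTop (𝓝 (∫ x, v x * pd i φ x)) := by
    set B : Euc n → ℝ := fun x => Real.exp (ψ x / 2) * pd i φ x with hB
    have hBc : Continuous B := hcp.mul (hφ.pd i).continuous
    have hBL : MemLp B 2 volume := hBc.memLp_of_hasCompactSupport (hφc.pd i).mul_left
    have i1 : Integrable (fun x => v x * pd i φ x) volume :=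
      hvloc.integrable_mul_of_hasCompactSupport (hφ.pd i).continuous (hφc.pd i)
    have i2 : ∀ k, Integrable (fun x => w k x * pd i φ x) volume := fun k =>
      ((hws k).continuous.mul (hφ.pd i).continuous).integrable_of_hasCompactSupport
        (hφc.pd i).mul_left
    rw [tendsto_iff_norm_sub_tendsto_zero]
    have hlim : Tendsto (fun k => √((∫ x, (conv (mollifier n k) h x - h x) ^ 2) * ∫ x, B x ^ 2))
        atTop (𝓝 0) := by
      simpa using (ha.mul_const (∫ x, B x ^ 2)).sqrt
    refine tendsto_of_tendsto_of_tendsto_of_le_of_le' tendsto_const_nhds hlim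
      (Eventually.of_forall fun k => norm_nonneg _) ?_
    filter_upwards [hee] with k hk
    rw [← integral_sub (i2 k) i1]
    refine Real.abs_le_sqrt ((le_of_eq ?_).trans (integral_mul_sq_le hk hBL))
    congr 2
    ext x
    rw [hvh]
    simp only [hw, hB, hg]
    ring
  set S : ℝ := ∫ x, φ x ^ 2 * Real.exp (ψ x) with hS
  have hS0 : 0 ≤ S := integral_nonneg fun x => by positivity
  set H : ℝ := ∫ x, h x ^ 2 with hH
  -- With the cutoff fixed, `k → ∞` removes the residual in Caccioppoli's inequality. What remains
  -- is the cutoff term of order `R⁻²` times `S`, which depends only on `φ` and `ψ`; then `R → ∞`.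
  have hbound : ∀ R, 0 < R → R₀ ≤ R → (∫ x, v x * pd i φ x) ^ 2 ≤ 4 * (C / R ^ 2 * (2 * H)) * S := by
    intro R hR hRR
    obtain ⟨χ, hχ, hχc, hχ0, hχ1, hχR, hχd⟩ := hC R hR
    have herr := tendsto_integral_mollified_error hhL hψ.pot.continuous hweak hχ0 hχ1 hχc
    have hlim : Tendsto (fun k => (2 * (∫ x, |χ x ^ 2 * (g k x *
          (lap (g k) x - pot ψ x * g k x))|) + 4 * (C / R ^ 2 *
          (2 * H + 2 * ∫ x, (conv (mollifier n k) h x - h x) ^ 2))) * S) atTop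
        (𝓝 ((2 * 0 + 4 * (C / R ^ 2 * (2 * H + 2 * 0))) * S)) :=
      ((herr.const_mul 2).add (((tendsto_const_nhds.add (ha.const_mul 2)).const_mul _).const_mul
        4)).mul_const S
    simp only [mul_zero, zero_add, add_zero] at hlim
    refine le_of_tendsto_of_tendsto (hpair.pow 2) hlim ?_
    filter_upwards [hee] with k hk
    have hgL : MemLp (g k) 2 volume := by
      have := hk.add hhL
      refine this.ae_eq (Eventually.of_forall fun x => ?_)
      simp [hg]
    have cac := caccioppoli hψ (hgs k) hχ hχc
    have hg2 : ∫ x, (∑ i, pd i χ x ^ 2) * g k x ^ 2 ≤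
        C / R ^ 2 * (2 * H + 2 * ∫ x, (conv (mollifier n k) h x - h x) ^ 2) := by
      have h1 : ∫ x, (∑ i, pd i χ x ^ 2) * g k x ^ 2 ≤ ∫ x, C / R ^ 2 * g k x ^ 2 :=
        integral_mono_of_nonneg (Eventually.of_forall fun x => by positivity)
          (hgL.integrable_sq.const_mul _) (Eventually.of_forall fun x => by
            simp only
            gcongr
            exact hχd x)
      rw [integral_const_mul] at h1
      refine h1.trans ?_
      gcongr
      have h2 := integral_add_sq_le hhL hk
      simpa [hg] using h2
    have hibp : ∫ x, w k x * pd i φ x = - ∫ x, pd i (w k) x * φ x :=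
      integral_mul_fderiv_eq_neg_fderiv_mul_of_integrable
        ((((hws k).pd i).continuous.mul hφ.continuous).integrable_of_hasCompactSupport
          hφc.mul_left)
        (((hws k).continuous.mul (hφ.pd i).continuous).integrable_of_hasCompactSupport
          (hφc.pd i).mul_left)
        (((hws k).continuous.mul hφ.continuous).integrable_of_hasCompactSupport hφc.mul_left)
        (fun x _ => (hws k).differentiable (by norm_num) x)
        (fun x _ => hφ.differentiable (by norm_num) x)
    set A : Euc n → ℝ := fun x => χ x * pd i (w k) x * Real.exp (-ψ x / 2) with hA
    set D : Euc n → ℝ := fun x => φ x * Real.exp (ψ x / 2) with hD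
    have hAL : MemLp A 2 volume :=
      ((hχ.continuous.mul ((hws k).pd i).continuous).mul hcq).memLp_of_hasCompactSupport
        hχc.mul_right.mul_right
    have hDL : MemLp D 2 volume :=
      (hφ.continuous.mul hcp).memLp_of_hasCompactSupport hφc.mul_right
    have hAD : ∫ x, pd i (w k) x * φ x = ∫ x, A x * D x := by
      refine integral_congr_ae (Eventually.of_forall fun x => ?_)
      simp only [hA, hD]
      by_cases hx : φ x = 0
      · simp [hx]
      · have hxR : ‖x‖ ≤ R := (by simpa using hR₀ (subset_tsupport _ hx) : ‖x‖ ≤ R₀).trans hRR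
        have ee : Real.exp (-ψ x / 2) * Real.exp (ψ x / 2) = 1 := by
          rw [← Real.exp_add]
          ring_nf
          simp
        rw [hχR x hxR]
        linear_combination (-pd i (w k) x * φ x) * ee
    have hA2 : ∫ x, A x ^ 2 ≤
        ∫ x, χ x ^ 2 * ∑ i, pd i (w k) x ^ 2 ∂(weighted ψ) := by
      rw [integral_weighted hψ.continuous]
      refine integral_mono_of_nonneg (Eventually.of_forall fun x => sq_nonneg _) ?_
        (Eventually.of_forall fun x => ?_)
      · refine Continuous.integrable_of_hasCompactSupport ?_ ?_
        · exact ((hχ.continuous.pow 2).mul (continuous_finsetSum _ fun j _ =>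
            ((hws k).pd j).continuous.pow 2)).mul (Real.continuous_exp.comp hψ.continuous.neg)
        · simp only [sq, mul_assoc]
          exact hχc.mul_right
      · simp only [hA, mul_pow, ← Real.exp_nat_mul]
        have e1 : ((2 : ℕ) : ℝ) * (-ψ x / 2) = -ψ x := by push_cast; ring
        rw [e1]
        gcongr
        exact Finset.single_le_sum (f := fun j => pd j (w k) x ^ 2) (fun j _ => sq_nonneg _)
          (Finset.mem_univ i)
    have hD2 : ∫ x, D x ^ 2 = S := by
      refine integral_congr_ae (Eventually.of_forall fun x => ?_)
      simp only [hD, mul_pow, ← Real.exp_nat_mul]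
      congr 2
      push_cast
      ring
    change (∫ x, w k x * pd i φ x) ^ 2 ≤ _
    rw [hibp, neg_sq, hAD]
    refine (integral_mul_sq_le hAL hDL).trans ?_
    rw [hD2]
    gcongr
    refine hA2.trans (cac.trans ?_)
    gcongr
  have hlimR : Tendsto (fun R : ℝ => 4 * (C / R ^ 2 * (2 * H)) * S) atTop (𝓝 0) := by
    have h1 : Tendsto (fun R : ℝ => C / R ^ 2) atTop (𝓝 0) :=
      tendsto_const_nhds.div_atTop (tendsto_pow_atTop (by norm_num))
    simpa using ((h1.mul_const (2 * H)).const_mul 4).mul_const S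
  have h0 : (∫ x, v x * pd i φ x) ^ 2 ≤ 0 :=
    ge_of_tendsto hlimR ((eventually_gt_atTop 0).and (eventually_ge_atTop R₀) |>.mono
      fun R hR => hbound R hR.1 hR.2)
  exact pow_eq_zero_iff (by norm_num) |>.1 (le_antisymm h0 (sq_nonneg _))

end Range

/-! ### Moments and covariance -/

section Moments

open Filter Topology

variable {n : ℕ} {ψ : Euc n → ℝ}

/-- The mean value theorem produces a point of (0, 1) where `f'` is the slope of the chord, and `f'`
is monotone. -/
lemma add_deriv_le_of_second_deriv_nonneg {f f' f'' : ℝ → ℝ} (h1 : ∀ s, HasDerivAt f (f' s) s)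
    (h2 : ∀ s, HasDerivAt f' (f'' s) s) (h0 : ∀ s, 0 ≤ f'' s) : f 0 + f' 0 ≤ f 1 := by
  have hmono : Monotone f' :=
    monotone_of_deriv_nonneg (fun s => (h2 s).differentiableAt) fun s => (h2 s).deriv ▸ h0 s
  obtain ⟨c, hc, hc'⟩ := exists_hasDerivAt_eq_slope f f' (zero_lt_one (α := ℝ))
    (fun s _ => (h1 s).continuousAt.continuousWithinAt) (fun s _ => h1 s)
  have := hmono hc.1.le
  rw [hc'] at this
  linarith

/-- Along the ray `s ↦ s • x`, subtracting `t / 2 * ‖x‖ ^ 2 * s ^ 2` from `ψ` leaves a convex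
function, which lies above its tangent at 0. -/
lemma quadratic_lower_bound (hψ : ContDiff ℝ ∞ ψ) {t : ℝ} (ht : HessGE ψ t) (x : Euc n) :
    ψ 0 + fderiv ℝ ψ 0 x + t / 2 * ‖x‖ ^ 2 ≤ ψ x := by
  have hline : ∀ s : ℝ, HasDerivAt (fun s : ℝ => s • x) x s := fun s => by
    simpa using (hasDerivAt_id s).smul_const x
  have d1 : ∀ s : ℝ, HasDerivAt (fun s : ℝ => ψ (s • x) - t / 2 * ‖x‖ ^ 2 * s ^ 2)
      (fderiv ℝ ψ (s • x) x - t * ‖x‖ ^ 2 * s) s := fun s => by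
    have h1 : HasDerivAt (fun s : ℝ => ψ (s • x)) (fderiv ℝ ψ (s • x) x) s :=
      (hψ.differentiable (by norm_num) (s • x)).hasFDerivAt.comp_hasDerivAt s (hline s)
    have h2 : HasDerivAt (fun s : ℝ => t / 2 * ‖x‖ ^ 2 * s ^ 2) (t * ‖x‖ ^ 2 * s) s := by
      refine ((hasDerivAt_pow 2 s).const_mul (t / 2 * ‖x‖ ^ 2)).congr_deriv ?_
      push_cast
      ring
    exact h1.fun_sub h2
  have d2 : ∀ s : ℝ, HasDerivAt (fun s : ℝ => fderiv ℝ ψ (s • x) x - t * ‖x‖ ^ 2 * s)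
      (hessForm ψ (s • x) x - t * ‖x‖ ^ 2) s := fun s => by
    have hd : DifferentiableAt ℝ (fderiv ℝ ψ) (s • x) :=
      (hψ.fderiv_right (m := ∞) (by norm_num)).differentiable (by norm_num) _
    have h0 : HasDerivAt (fun s : ℝ => fderiv ℝ ψ (s • x)) (fderiv ℝ (fderiv ℝ ψ) (s • x) x) s :=
      hd.hasFDerivAt.comp_hasDerivAt s (hline s)
    have h1 : HasDerivAt (fun s : ℝ => fderiv ℝ ψ (s • x) x) (hessForm ψ (s • x) x) s := by
      refine (h0.clm_apply (hasDerivAt_const s x)).congr_deriv ?_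
      simp [hessForm]
    have h2 : HasDerivAt (fun s : ℝ => t * ‖x‖ ^ 2 * s) (t * ‖x‖ ^ 2) s := by
      simpa using (hasDerivAt_id s).const_mul (t * ‖x‖ ^ 2)
    exact h1.fun_sub h2
  have h := add_deriv_le_of_second_deriv_nonneg d1 d2 fun s => by linarith [ht (s • x) x]
  rw [zero_smul, one_smul] at h
  linarith

/-- Strong convexity gives Gaussian tails. Of the coefficient `t / 2` in the exponent, `t / 8`
absorbs the linear term of `ψ` at the origin, `t / 8` absorbs the factor `‖x‖ ^ 2`, and `t / 4` is
left for integrability. -/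
lemma integrable_norm_sq_weighted (hψ : ContDiff ℝ ∞ ψ) {t : ℝ} (ht0 : 0 < t) (ht : HessGE ψ t) :
    Integrable (fun x => ‖x‖ ^ 2) (weighted ψ) := by
  rw [integrable_weighted_iff hψ.continuous]
  have hgauss : Integrable (fun x : Euc n => Real.exp (-(t / 4) * ‖x‖ ^ 2)) := by
    have h := (GaussianFourier.integrable_cexp_neg_mul_sq_norm_add (V := Euc n) (b := ((t / 4 : ℝ) : ℂ))
      (by rw [Complex.ofReal_re]; positivity) 0 0).norm
    refine h.congr (Eventually.of_forall fun x => ?_)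
    simp only [zero_mul, add_zero]
    rw [Complex.norm_exp]
    congr 1
    rw [← Complex.ofReal_neg, ← Complex.ofReal_pow, ← Complex.ofReal_mul, Complex.ofReal_re]
  set a : ℝ := ‖fderiv ℝ ψ 0‖
  refine (hgauss.const_mul (8 / t * Real.exp (-ψ 0 + 2 * a ^ 2 / t))).mono'
    (by have := hψ.continuous; fun_prop) (Eventually.of_forall fun x => ?_)
  have h1 := quadratic_lower_bound hψ ht x
  have h2 : -(a * ‖x‖) ≤ fderiv ℝ ψ 0 x :=
    (neg_le_neg ((fderiv ℝ ψ 0).le_opNorm x)).trans (neg_abs_le _)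
  have h3 : a * ‖x‖ ≤ t / 8 * ‖x‖ ^ 2 + 2 * a ^ 2 / t := by
    have : t / 8 * ‖x‖ ^ 2 + 2 * a ^ 2 / t - a * ‖x‖ = (t * ‖x‖ - 4 * a) ^ 2 / (8 * t) := by
      field_simp
      ring
    have h : 0 ≤ (t * ‖x‖ - 4 * a) ^ 2 / (8 * t) := by positivity
    linarith
  have h4 : ‖x‖ ^ 2 ≤ 8 / t * Real.exp (t / 8 * ‖x‖ ^ 2) := by
    have := Real.add_one_le_exp (t / 8 * ‖x‖ ^ 2)
    rw [div_mul_eq_mul_div, le_div_iff₀ ht0]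
    linarith
  rw [Real.norm_of_nonneg (by positivity)]
  calc ‖x‖ ^ 2 * Real.exp (-ψ x) ≤ (8 / t * Real.exp (t / 8 * ‖x‖ ^ 2)) *
        Real.exp (-ψ 0 + 2 * a ^ 2 / t + t / 8 * ‖x‖ ^ 2 - t / 2 * ‖x‖ ^ 2) := by
        gcongr
        linarith
    _ = 8 / t * Real.exp (-ψ 0 + 2 * a ^ 2 / t) * Real.exp (-(t / 4) * ‖x‖ ^ 2) := by
        rw [mul_assoc, mul_assoc, ← Real.exp_add, ← Real.exp_add]
        congr 2
        ring

lemma memLp_coord_weighted (hψ : ContDiff ℝ ∞ ψ) {t : ℝ} (ht0 : 0 < t)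
    (ht : HessGE ψ t) (i : Fin n) : MemLp (fun x : Euc n => x i) 2 (weighted ψ) := by
  have hm : AEStronglyMeasurable (fun x : Euc n => x i) (weighted ψ) := by fun_prop
  rw [memLp_two_iff_integrable_sq hm]
  refine (integrable_norm_sq_weighted hψ ht0 ht).mono' (hm.pow 2) (Eventually.of_forall fun x => ?_)
  rw [norm_pow]
  exact pow_le_pow_left₀ (norm_nonneg _) (PiLp.norm_apply_le x i) 2

/-- The centered linear function `x ↦ ⟨a, x - E x⟩`. -/
noncomputable def centeredLinear (μ : Measure (Euc n)) (a : Euc n) : Euc n → ℝ :=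
  fun x => ∑ i, a i * (x i - ∫ y, y i ∂μ)

lemma contDiff_centeredLinear (μ : Measure (Euc n)) (a : Euc n) :
    ContDiff ℝ ∞ (centeredLinear μ a) := by
  unfold centeredLinear
  fun_prop

lemma pd_centeredLinear (μ : Measure (Euc n)) (a : Euc n) (i : Fin n) (x : Euc n) :
    pd i (centeredLinear μ a) x = a i := by
  have h : HasFDerivAt (centeredLinear μ a)
      (∑ j, a j • (EuclideanSpace.proj j : Euc n →L[ℝ] ℝ)) x := by
    unfold centeredLinear
    refine HasFDerivAt.fun_sum fun j _ => HasFDerivAt.const_mul ?_ (a j)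
    exact (EuclideanSpace.proj (𝕜 := ℝ) j).hasFDerivAt.sub_const _
  rw [pd, h.fderiv]
  simp [sum_apply, PiLp.single_apply]

lemma memLp_centeredLinear {μ : Measure (Euc n)} [IsFiniteMeasure μ]
    (h : ∀ i, MemLp (fun x : Euc n => x i) 2 μ) (a : Euc n) : MemLp (centeredLinear μ a) 2 μ :=
  memLp_finsetSum _ fun i _ => ((h i).sub (memLp_const _)).const_mul (a i)

lemma integral_centeredLinear {μ : Measure (Euc n)} [IsProbabilityMeasure μ]
    (h : ∀ i, MemLp (fun x : Euc n => x i) 2 μ) (a : Euc n) :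
    ∫ x, centeredLinear μ a x ∂μ = 0 := by
  have hi : ∀ i, Integrable (fun x : Euc n => x i) μ := fun i => (h i).integrable (by norm_num)
  unfold centeredLinear
  have hs : ∀ i, Integrable (fun x : Euc n => a i * (x i - ∫ y, y i ∂μ)) μ := fun i =>
    ((hi i).sub (integrable_const _)).const_mul (a i)
  rw [integral_finsetSum _ fun i _ => hs i]
  refine Finset.sum_eq_zero fun i _ => ?_
  rw [integral_const_mul, integral_sub (hi i) (integrable_const _)]
  simp

lemma integral_centeredLinear_sq {μ : Measure (Euc n)} [IsFiniteMeasure μ]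
    (h : ∀ i, MemLp (fun x : Euc n => x i) 2 μ) (a : Euc n) :
    ∫ x, centeredLinear μ a x ^ 2 ∂μ =
      inner ℝ a (Matrix.toEuclideanCLM (n := Fin n) (𝕜 := ℝ) (covMat μ) a) := by
  have hc : ∀ i, MemLp (fun x : Euc n => x i - ∫ y, y i ∂μ) 2 μ := fun i =>
    (h i).sub (memLp_const _)
  have hint : ∀ i j, Integrable (fun x : Euc n => a i * (x i - ∫ y, y i ∂μ) *
      (a j * (x j - ∫ y, y j ∂μ))) μ := fun i j =>
    ((hc i).const_mul (a i)).integrable_mul ((hc j).const_mul (a j))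
  have e1 : ∀ x, centeredLinear μ a x ^ 2 = ∑ i, ∑ j, a i * (x i - ∫ y, y i ∂μ) *
      (a j * (x j - ∫ y, y j ∂μ)) := fun x => by
    rw [sq, centeredLinear, Finset.sum_mul_sum]
  simp only [e1]
  rw [integral_finsetSum _ fun i _ => integrable_finsetSum _ fun j _ => hint i j]
  simp only [PiLp.inner_apply, Matrix.ofLp_toEuclideanCLM, Matrix.mulVec, dotProduct]
  refine Finset.sum_congr rfl fun i _ => ?_
  rw [integral_finsetSum _ fun j _ => hint i j]
  simp only [RCLike.inner_apply, conj_trivial, Finset.sum_mul]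
  refine Finset.sum_congr rfl fun j _ => ?_
  simp only [covMat, Matrix.of_apply, covariance]
  rw [mul_assoc, ← integral_mul_const]
  refine integral_congr_ae (Eventually.of_forall fun x => ?_)
  simp only
  ring

lemma integral_centeredLinear_sq_le {μ : Measure (Euc n)} [IsFiniteMeasure μ]
    (h : ∀ i, MemLp (fun x : Euc n => x i) 2 μ) (a : Euc n) :
    ∫ x, centeredLinear μ a x ^ 2 ∂μ ≤ matOpNorm (covMat μ) * ‖a‖ ^ 2 := by
  rw [integral_centeredLinear_sq h]
  refine (real_inner_le_norm _ _).trans ?_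
  have := (Matrix.toEuclideanCLM (n := Fin n) (𝕜 := ℝ) (covMat μ)).le_opNorm a
  rw [matOpNorm]
  nlinarith [norm_nonneg a]

/-- The mean of `∇u` is controlled by the covariance and the `L²` norm of `Lu`. -/
lemma sum_integral_pd_sq_le [IsFiniteMeasure (weighted ψ)] (hψ : ContDiff ℝ ∞ ψ) {t : ℝ}
    (ht0 : 0 < t) (ht : HessGE ψ t) {u : Euc n → ℝ} (hu : ContDiff ℝ ∞ u)
    (hc : HasCompactSupport u) :
    ∑ i, (∫ x, pd i u x ∂(weighted ψ)) ^ 2 ≤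
      matOpNorm (covMat (weighted ψ)) * ∫ x, gen ψ u x ^ 2 ∂(weighted ψ) := by
  have hmem := memLp_coord_weighted hψ ht0 ht
  -- With `a` the mean of ∇u, Green's formula against the centred linear function of gradient `a`
  -- gives exactly `-‖a‖ ^ 2`. Cauchy–Schwarz then has `‖a‖ ^ 4` on the left and a single factor
  -- `‖a‖ ^ 2` on the right.
  set a : Euc n := WithLp.toLp 2 fun i => ∫ x, pd i u x ∂(weighted ψ) with ha
  have hna : ‖a‖ ^ 2 = ∑ i, (∫ x, pd i u x ∂(weighted ψ)) ^ 2 := by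
    rw [EuclideanSpace.norm_sq_eq]
    simp [ha]
  have hL : MemLp (gen ψ u) 2 (weighted ψ) :=
    (hψ.gen hu).continuous.memLp_of_hasCompactSupport (hc.gen ψ)
  have green := integral_gen_mul hψ hu
    ((contDiff_centeredLinear (weighted ψ) a).of_le (by norm_num : (1 : WithTop ℕ∞) ≤ ∞))
    (Or.inl hc)
  simp only [pd_centeredLinear] at green
  rw [integral_finsetSum _ fun i _ =>
    ((hu.pd i).continuous.integrable_of_hasCompactSupport (hc.pd i)).mul_const (a i)] at green
  simp only [integral_mul_const] at green
  have e : ∑ i, (∫ x, pd i u x ∂(weighted ψ)) * a i = ‖a‖ ^ 2 := by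
    rw [hna]
    exact Finset.sum_congr rfl fun i _ => by simp [ha, sq]
  have cs := integral_mul_sq_le hL (memLp_centeredLinear hmem a)
  rw [green, e, neg_sq] at cs
  have h1 := integral_centeredLinear_sq_le hmem a
  have hI : 0 ≤ ∫ x, gen ψ u x ^ 2 ∂(weighted ψ) := integral_nonneg fun x => sq_nonneg _
  rw [← hna]
  rcases (sq_nonneg ‖a‖).eq_or_lt with h0 | h0
  · rw [← h0]
    exact mul_nonneg (norm_nonneg _) hI
  · refine le_of_mul_le_mul_right ?_ h0
    calc ‖a‖ ^ 2 * ‖a‖ ^ 2 = (‖a‖ ^ 2) ^ 2 := by ring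
      _ ≤ _ := cs
      _ ≤ (∫ x, gen ψ u x ^ 2 ∂(weighted ψ)) * (matOpNorm (covMat (weighted ψ)) * ‖a‖ ^ 2) := by
          gcongr
      _ = _ := by ring

end Moments

/-! ### Improvement of the spectral gap -/

section Gap

open Filter Topology

variable {n : ℕ} {ψ : Euc n → ℝ}

/-- The squared length of the gradient. -/
noncomputable def gradSq (f : Euc n → ℝ) : Euc n → ℝ := fun x => ∑ i, pd i f x ^ 2

lemma gradSq_nonneg (f : Euc n → ℝ) (x : Euc n) : 0 ≤ gradSq f x :=
  Finset.sum_nonneg fun _ _ => sq_nonneg _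

lemma ContDiff.continuous_gradSq {f : Euc n → ℝ} (hf : ContDiff ℝ 1 f) : Continuous (gradSq f) :=
  continuous_finsetSum _ fun i _ => (hf.continuous_pd i).pow 2

/-- The Poincaré inequality `lam * Var f ≤ ∫ |∇f|²` for bounded `C¹` functions. -/
def SpectralGap (μ : Measure (Euc n)) (lam : ℝ) : Prop :=
  ∀ f : Euc n → ℝ, ContDiff ℝ 1 f → (∃ B, ∀ x, |f x| ≤ B) → Integrable (gradSq f) μ →
    lam * (∫ x, f x ^ 2 ∂μ - (∫ x, f x ∂μ) ^ 2) ≤ ∫ x, gradSq f x ∂μ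

lemma memLp_of_abs_le {μ : Measure (Euc n)} [IsFiniteMeasure μ] {f : Euc n → ℝ}
    (hf : Continuous f) (hb : ∃ B, ∀ x, |f x| ≤ B) : MemLp f 2 μ := by
  obtain ⟨B, hB⟩ := hb
  exact MemLp.of_bound hf.aestronglyMeasurable B (Eventually.of_forall hB)

lemma integral_sub_mean_sq {μ : Measure (Euc n)} [IsProbabilityMeasure μ] {f : Euc n → ℝ}
    (hf : MemLp f 2 μ) :
    ∫ x, (f x - ∫ y, f y ∂μ) ^ 2 ∂μ = ∫ x, f x ^ 2 ∂μ - (∫ x, f x ∂μ) ^ 2 := by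
  have h := variance_eq_sub hf
  rw [variance_eq_integral hf.1.aemeasurable] at h
  simpa using h

lemma integral_sq_sub_sq_nonneg {μ : Measure (Euc n)} [IsProbabilityMeasure μ] {f : Euc n → ℝ}
    (hf : MemLp f 2 μ) : 0 ≤ ∫ x, f x ^ 2 ∂μ - (∫ x, f x ∂μ) ^ 2 := by
  rw [← integral_sub_mean_sq hf]
  exact integral_nonneg fun x => sq_nonneg _

lemma integral_sum_mul_sq_le {μ : Measure (Euc n)} {a b : Fin n → Euc n → ℝ}
    (ha : ∀ i, Continuous (a i)) (hb : ∀ i, Continuous (b i))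
    (ha2 : Integrable (fun x => ∑ i, a i x ^ 2) μ) (hb2 : Integrable (fun x => ∑ i, b i x ^ 2) μ) :
    (∫ x, ∑ i, a i x * b i x ∂μ) ^ 2 ≤ (∫ x, ∑ i, a i x ^ 2 ∂μ) * ∫ x, ∑ i, b i x ^ 2 ∂μ := by
  have hA0 : ∀ x, 0 ≤ ∑ i, a i x ^ 2 := fun x => Finset.sum_nonneg fun _ _ => sq_nonneg _
  have hB0 : ∀ x, 0 ≤ ∑ i, b i x ^ 2 := fun x => Finset.sum_nonneg fun _ _ => sq_nonneg _
  have hAm : AEStronglyMeasurable (fun x => √(∑ i, a i x ^ 2)) μ :=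
    (continuous_finsetSum _ fun i _ => (ha i).pow 2).sqrt.aestronglyMeasurable
  have hBm : AEStronglyMeasurable (fun x => √(∑ i, b i x ^ 2)) μ :=
    (continuous_finsetSum _ fun i _ => (hb i).pow 2).sqrt.aestronglyMeasurable
  have hA : MemLp (fun x => √(∑ i, a i x ^ 2)) 2 μ := by
    rw [memLp_two_iff_integrable_sq hAm]
    simpa only [Real.sq_sqrt (hA0 _)] using ha2
  have hB : MemLp (fun x => √(∑ i, b i x ^ 2)) 2 μ := by
    rw [memLp_two_iff_integrable_sq hBm]
    simpa only [Real.sq_sqrt (hB0 _)] using hb2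
  have h := integral_mul_sq_le hA hB
  simp only [Real.sq_sqrt (hA0 _), Real.sq_sqrt (hB0 _)] at h
  refine le_trans ?_ h
  rw [sq_le_sq]
  refine le_trans ?_ (le_abs_self _)
  refine abs_integral_le_integral_abs.trans (integral_mono_of_nonneg
    (Eventually.of_forall fun x => abs_nonneg _) (hA.integrable_mul hB)
    (Eventually.of_forall fun x => ?_))
  simp only
  rw [← Real.sqrt_mul (hA0 x)]
  exact Real.abs_le_sqrt (Finset.sum_mul_sq_le_sq_mul_sq _ _ _)

/-- The Bochner formula combined with a spectral gap for the partial derivatives. -/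
lemma gap_energy_le [IsProbabilityMeasure (weighted ψ)] (hψ : ContDiff ℝ ∞ ψ) {t lam : ℝ}
    (ht0 : 0 < t) (ht : HessGE ψ t) (hlam : 0 ≤ lam) (hgap : SpectralGap (weighted ψ) lam)
    {u : Euc n → ℝ} (hu : ContDiff ℝ ∞ u) (hc : HasCompactSupport u) :
    (lam + t) * ∫ x, gradSq u x ∂(weighted ψ) ≤
      (1 + lam * matOpNorm (covMat (weighted ψ))) * ∫ x, gen ψ u x ^ 2 ∂(weighted ψ) := by
  have hint : ∀ i, Integrable (fun x => pd i u x ^ 2) (weighted ψ) := fun i => by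
    refine ((hu.pd i).continuous.pow 2).integrable_of_hasCompactSupport ?_
    simp only [sq]
    exact (hc.pd i).mul_right
  have hG : ∫ x, gradSq u x ∂(weighted ψ) = ∑ i, ∫ x, pd i u x ^ 2 ∂(weighted ψ) :=
    integral_finsetSum _ fun i _ => hint i
  have hGi : Integrable (gradSq u) (weighted ψ) := integrable_finsetSum _ fun i _ => hint i
  have hB := integral_gen_sq hψ hu hc
  -- The partial derivatives are not centred, so the gap only controls their variances; `h3` pays
  -- for the squared means.
  have h1 : ∀ i, lam * (∫ x, pd i u x ^ 2 ∂(weighted ψ) - (∫ x, pd i u x ∂(weighted ψ)) ^ 2) ≤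
      ∫ x, ∑ j, pd j (pd i u) x ^ 2 ∂(weighted ψ) := fun i => by
    refine hgap (pd i u) ((hu.pd i).of_le (by norm_num)) ?_ ?_
    · exact (hu.pd i).continuous.bounded_above_of_compact_support (hc.pd i)
    · refine integrable_finsetSum _ fun j _ =>
        (((hu.pd i).pd j).continuous.pow 2).integrable_of_hasCompactSupport ?_
      simp only [sq]
      exact ((hc.pd i).pd j).mul_right
  have h2 : t * ∫ x, gradSq u x ∂(weighted ψ) ≤
      ∫ x, ∑ i, ∑ j, pd i u x * pd j u x * pd i (pd j ψ) x ∂(weighted ψ) := by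
    rw [← integral_const_mul]
    refine integral_mono (hGi.const_mul t) (integrable_finsetSum _ fun i _ =>
      integrable_finsetSum _ fun j _ => (((hu.pd i).continuous.mul (hu.pd j).continuous).mul
        ((hψ.pd j).pd i).continuous).integrable_of_hasCompactSupport
          ((hc.pd i).mul_right.mul_right)) fun x => ?_
    have h := ht x (WithLp.toLp 2 fun i => pd i u x)
    rw [hessForm_eq_sum hψ, EuclideanSpace.norm_sq_eq] at h
    simpa [gradSq] using h
  have h3 := sum_integral_pd_sq_le hψ ht0 ht hu hc
  have h4 := Finset.sum_le_sum fun i (_ : i ∈ Finset.univ) => h1 i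
  rw [← Finset.mul_sum, Finset.sum_sub_distrib, ← hG] at h4
  have h5 := mul_le_mul_of_nonneg_left h3 hlam
  nlinarith

/-- The range of the weighted Laplacian on test functions, in `L²`. -/
noncomputable def genRange (ψ : Euc n → ℝ) : Submodule ℝ (Lp ℝ 2 (weighted ψ)) where
  carrier := {G | ∃ u : Euc n → ℝ, ContDiff ℝ ∞ u ∧ HasCompactSupport u ∧
    G =ᵐ[weighted ψ] gen ψ u}
  zero_mem' := by
    refine ⟨fun _ => 0, contDiff_const, HasCompactSupport.zero, ?_⟩
    have h : gen ψ (fun _ : Euc n => (0 : ℝ)) = 0 := by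
      have hp : ∀ i, pd i (fun _ : Euc n => (0 : ℝ)) = fun _ => 0 := fun i => by
        ext x
        simp [pd]
      ext x
      simp [gen, hp]
    rw [h]
    exact Lp.coeFn_zero _ _ _
  add_mem' := by
    rintro F G ⟨u, hu, huc, hF⟩ ⟨v, hv, hvc, hG⟩
    refine ⟨fun x => u x + v x, hu.add hv, huc.add hvc, ?_⟩
    filter_upwards [Lp.coeFn_add F G, hF, hG] with x h1 h2 h3
    have hpd : ∀ {f g : Euc n → ℝ}, ContDiff ℝ ∞ f → ContDiff ℝ ∞ g → ∀ i,
        pd i (fun x => f x + g x) = fun x => pd i f x + pd i g x := fun hf hg i => by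
      ext y
      simp only [pd]
      rw [fderiv_fun_add (hf.differentiable (by norm_num) y) (hg.differentiable (by norm_num) y)]
      rfl
    rw [h1, Pi.add_apply, h2, h3]
    simp only [gen, hpd hu hv, hpd (hu.pd _) (hv.pd _), ← Finset.sum_add_distrib]
    exact Finset.sum_congr rfl fun i _ => by ring
  smul_mem' := by
    rintro c G ⟨u, hu, huc, hG⟩
    refine ⟨fun x => c * u x, contDiff_const.mul hu, huc.mul_left, ?_⟩
    filter_upwards [Lp.coeFn_smul c G, hG] with x h1 h2
    have hpd : ∀ {f : Euc n → ℝ}, ContDiff ℝ ∞ f → ∀ i,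
        pd i (fun x => c * f x) = fun x => c * pd i f x := fun hf i => by
      ext y
      simp only [pd]
      rw [fderiv_const_mul (hf.differentiable (by norm_num) y)]
      rfl
    rw [h1, Pi.smul_apply, h2]
    simp only [gen, hpd hu, hpd (hu.pd _), smul_eq_mul, Finset.mul_sum]
    exact Finset.sum_congr rfl fun i _ => by ring

/-- The closure of a subspace is its double orthogonal complement, and the orthogonal complement of
the range consists of constants, against which a centred function integrates to zero. -/
lemma mem_closure_genRange [IsProbabilityMeasure (weighted ψ)] (hψ : ContDiff ℝ ∞ ψ)
    (F : Lp ℝ 2 (weighted ψ)) (hF : ∫ x, F x ∂(weighted ψ) = 0) :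
    F ∈ (genRange ψ).topologicalClosure := by
  rw [← Submodule.orthogonal_orthogonal_eq_closure, Submodule.mem_orthogonal]
  intro w hw
  rw [Submodule.mem_orthogonal] at hw
  obtain ⟨c, hc⟩ := ae_eq_const_of_orthogonal_gen hψ (Lp.memLp w) fun u hu huc => by
    have hL : MemLp (gen ψ u) 2 (weighted ψ) :=
      (hψ.gen hu).continuous.memLp_of_hasCompactSupport (huc.gen ψ)
    have h := hw (hL.toLp _) ⟨u, hu, huc, hL.coeFn_toLp⟩
    rw [L2.inner_def] at h
    rw [← h]
    refine integral_congr_ae ?_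
    filter_upwards [hL.coeFn_toLp] with x hx
    rw [hx]
    simp
  rw [L2.inner_def]
  have : ∫ x, inner ℝ (w x) (F x) ∂(weighted ψ) = ∫ x, F x * c ∂(weighted ψ) := by
    refine integral_congr_ae ?_
    filter_upwards [hc] with x hx
    rw [hx]
    simp
  rw [this, integral_mul_const, hF, zero_mul]

/-- A spectral gap `lam` improves to `(lam + t) / (1 + lam * V)`. -/
lemma SpectralGap.improve [IsProbabilityMeasure (weighted ψ)] (hψ : ContDiff ℝ ∞ ψ) {t lam : ℝ}
    (ht0 : 0 < t) (ht : HessGE ψ t) (hlam : 0 ≤ lam) (hgap : SpectralGap (weighted ψ) lam) :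
    SpectralGap (weighted ψ) ((lam + t) / (1 + lam * matOpNorm (covMat (weighted ψ)))) := by
  intro f hf hb hE
  set V := matOpNorm (covMat (weighted ψ)) with hV
  have hV0 : 0 ≤ V := norm_nonneg _
  have hfL := memLp_of_abs_le (μ := weighted ψ) hf.continuous hb
  set m : ℝ := ∫ x, f x ∂(weighted ψ) with hm
  have hf0L : MemLp (fun x => f x - m) 2 (weighted ψ) := hfL.sub (memLp_const _)
  have hf0 : ContDiff ℝ 1 fun x => f x - m := hf.sub contDiff_const
  have hpd0 : ∀ i, pd i (fun x => f x - m) = pd i f := fun i => by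
    ext x
    simp only [pd, fderiv_sub_const]
  set F : Lp ℝ 2 (weighted ψ) := hf0L.toLp _ with hF
  have hFmean : ∫ x, F x ∂(weighted ψ) = 0 := by
    rw [integral_congr_ae hf0L.coeFn_toLp,
      integral_sub (hfL.integrable (by norm_num)) (integrable_const _)]
    simp [hm]
  set K : ℝ := ∫ x, gradSq f x ∂(weighted ψ) with hK
  have hK0 : 0 ≤ K := integral_nonneg fun x => gradSq_nonneg f x
  have hnorm : ∀ G : Lp ℝ 2 (weighted ψ), ‖G‖ ^ 2 = ∫ x, G x ^ 2 ∂(weighted ψ) := fun G => by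
    rw [← real_inner_self_eq_norm_sq, L2.inner_def]
    simp [sq]
  -- On `G = gen ψ u` this is Cauchy–Schwarz for `∫ ∇u · ∇f` followed by `gap_energy_le`. The
  -- gradient of `u` no longer appears, so the condition is closed in L² and passes to the closure
  -- of the range.
  set Q : Set (Lp ℝ 2 (weighted ψ)) :=
    {G | (lam + t) * (inner ℝ F G) ^ 2 ≤ (1 + lam * V) * ‖G‖ ^ 2 * K} with hQ
  have hQc : IsClosed Q := isClosed_le (by fun_prop) (by fun_prop)
  have hsub : (genRange ψ : Set (Lp ℝ 2 (weighted ψ))) ⊆ Q := by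
    rintro G ⟨u, hu, huc, hG⟩
    have h1 : inner ℝ F G = - ∫ x, ∑ i, pd i u x * pd i f x ∂(weighted ψ) := by
      have green := integral_gen_mul hψ hu hf0 (Or.inl huc)
      simp only [hpd0] at green
      rw [← green, L2.inner_def]
      refine integral_congr_ae ?_
      filter_upwards [hG, hf0L.coeFn_toLp] with x h1 h2
      rw [h1, h2]
      simp
    have h2 : ‖G‖ ^ 2 = ∫ x, gen ψ u x ^ 2 ∂(weighted ψ) := by
      rw [hnorm]
      refine integral_congr_ae ?_
      filter_upwards [hG] with x h1
      rw [h1]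
    have hui : Integrable (fun x => ∑ i, pd i u x ^ 2) (weighted ψ) := by
      refine integrable_finsetSum _ fun i _ =>
        ((hu.pd i).continuous.pow 2).integrable_of_hasCompactSupport ?_
      simp only [sq]
      exact (huc.pd i).mul_right
    have h3 := integral_sum_mul_sq_le (fun i => (hu.pd i).continuous)
      (fun i => hf.continuous_pd i) hui hE
    have h4 := gap_energy_le hψ ht0 ht hlam hgap hu huc
    change (lam + t) * (inner ℝ F G) ^ 2 ≤ (1 + lam * V) * ‖G‖ ^ 2 * K
    rw [h1, h2, neg_sq]
    calc (lam + t) * (∫ x, ∑ i, pd i u x * pd i f x ∂(weighted ψ)) ^ 2 ≤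
        (lam + t) * ((∫ x, gradSq u x ∂(weighted ψ)) * K) := by
          gcongr
          exact h3
      _ = ((lam + t) * ∫ x, gradSq u x ∂(weighted ψ)) * K := by ring
      _ ≤ _ := by gcongr
  -- At `G = F` both sides contain `‖F‖ ^ 2`; cancelling one factor leaves the improved gap.
  have hFQ : F ∈ Q := closure_minimal hsub hQc (mem_closure_genRange hψ F hFmean)
  change (lam + t) * (inner ℝ F F) ^ 2 ≤ (1 + lam * V) * ‖F‖ ^ 2 * K at hFQ
  rw [real_inner_self_eq_norm_sq] at hFQ
  have hFn : ‖F‖ ^ 2 = ∫ x, f x ^ 2 ∂(weighted ψ) - m ^ 2 := by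
    rw [hnorm, ← integral_sub_mean_sq hfL]
    refine integral_congr_ae ?_
    filter_upwards [hf0L.coeFn_toLp] with x h1
    rw [h1]
  rw [← hFn]
  have hpos : 0 < 1 + lam * V := by positivity
  rcases (sq_nonneg ‖F‖).eq_or_lt with h0 | h0
  · rw [← h0, mul_zero]
    exact hK0
  · rw [div_mul_eq_mul_div, div_le_iff₀ hpos]
    refine le_of_mul_le_mul_right ?_ h0
    nlinarith

/-- The improved Lichnerowicz inequality for the spectral gap. -/
lemma spectralGap_of_sq_mul_le [IsProbabilityMeasure (weighted ψ)] (hψ : ContDiff ℝ ∞ ψ) {t s : ℝ}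
    (ht0 : 0 < t) (ht : HessGE ψ t) (hs : 0 ≤ s)
    (hst : s ^ 2 * matOpNorm (covMat (weighted ψ)) ≤ t) : SpectralGap (weighted ψ) s := by
  set V := matOpNorm (covMat (weighted ψ)) with hV
  have hV0 : 0 ≤ V := norm_nonneg _
  -- The cap at `s` keeps the supremum finite even if every number were a gap.
  set S : Set ℝ := {lam | 0 ≤ lam ∧ lam ≤ s ∧ SpectralGap (weighted ψ) lam} with hS
  have h0 : (0 : ℝ) ∈ S := ⟨le_rfl, hs, fun f _ _ _ => by
    rw [zero_mul]
    exact integral_nonneg fun x => gradSq_nonneg f x⟩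
  have hbdd : BddAbove S := ⟨s, fun lam h => h.2.1⟩
  -- For each `f` of positive variance a gap is just an upper bound on `lam`, so the supremum is
  -- itself a gap.
  have hmem : sSup S ∈ S := by
    refine ⟨le_csSup hbdd h0, csSup_le ⟨0, h0⟩ fun lam h => h.2.1, fun f hf hb hE => ?_⟩
    have hv := integral_sq_sub_sq_nonneg (memLp_of_abs_le (μ := weighted ψ) hf.continuous hb)
    rcases hv.eq_or_lt with h | h
    · rw [← h, mul_zero]
      exact integral_nonneg fun x => gradSq_nonneg f x
    · rw [← le_div_iff₀ h]
      refine csSup_le ⟨0, h0⟩ fun lam hl => ?_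
      rw [le_div_iff₀ h]
      exact hl.2.2 f hf hb hE
  set l := sSup S with hl
  rcases hmem.2.1.eq_or_lt with h | h
  · exact h ▸ hmem.2.2
  exfalso
  have himp := SpectralGap.improve hψ ht0 ht hmem.1 hmem.2.2
  rw [← hV] at himp
  have hpos : 0 < 1 + l * V := by have := hmem.1; positivity
  have hlt : l ^ 2 * V < t := by
    rcases hV0.eq_or_lt with hv | hv
    · rw [← hv, mul_zero]
      exact ht0
    · refine lt_of_lt_of_le ?_ hst
      have := pow_lt_pow_left₀ h hmem.1 two_ne_zero
      gcongr
  -- After clearing the denominator this is `l ^ 2 * V < t`.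
  have hgt : l < (l + t) / (1 + l * V) := by
    rw [lt_div_iff₀ hpos]
    nlinarith
  have hmin : min s ((l + t) / (1 + l * V)) ∈ S := by
    refine ⟨le_min hs (hmem.1.trans hgt.le), min_le_left _ _, fun f hf hb hE => ?_⟩
    have hv := integral_sq_sub_sq_nonneg (memLp_of_abs_le (μ := weighted ψ) hf.continuous hb)
    exact (mul_le_mul_of_nonneg_right (min_le_right _ _) hv).trans (himp f hf hb hE)
  exact absurd (le_csSup hbdd hmin) (not_le.2 (lt_min h hgt))

end Gap

/-! ### From the spectral gap to the Poincaré constant -/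

section Poincare

open Filter Topology

variable {n : ℕ}

lemma enorm_gradient_sq (f : Euc n → ℝ) (x : Euc n) :
    ‖gradient f x‖ₑ ^ 2 = ENNReal.ofReal (gradSq f x) := by
  rw [← ofReal_norm, ← ENNReal.ofReal_pow (norm_nonneg _), norm_gradient_sq]
  rfl

lemma enorm_sq_eq_ofReal (r : ℝ) : ‖r‖ₑ ^ 2 = ENNReal.ofReal (r ^ 2) := by
  rw [← ofReal_norm, ← ENNReal.ofReal_pow (norm_nonneg _), Real.norm_eq_abs, sq_abs]

lemma tendsto_mul_sin_div (y : ℝ) :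
    Tendsto (fun k : ℕ => ((k : ℝ) + 1) * Real.sin (y / (k + 1))) atTop (𝓝 y) := by
  have h0 : Tendsto (fun k : ℕ => y * (1 / ((k : ℝ) + 1))) atTop (𝓝 (y * 0)) :=
    tendsto_one_div_add_atTop_nhds_zero_nat.const_mul y
  have h1 : Tendsto (fun k : ℕ => y * Real.sinc (y / ((k : ℝ) + 1))) atTop (𝓝 (y * Real.sinc 0)) := by
    refine Tendsto.const_mul y ((Real.continuous_sinc.tendsto 0).comp ?_)
    simpa [div_eq_mul_inv] using h0
  rw [Real.sinc_zero, mul_one] at h1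
  refine h1.congr fun k => ?_
  have hk : (k : ℝ) + 1 ≠ 0 := by positivity
  by_cases hy : y = 0
  · simp [hy]
  · rw [Real.sinc_of_ne_zero (div_ne_zero hy hk)]
    field_simp

/-- A spectral gap for bounded functions bounds the Poincaré constant. -/
lemma poincareConst_le_of_spectralGap {μ : Measure (Euc n)} [IsProbabilityMeasure μ] {s : ℝ}
    (hs : 0 < s) (hgap : SpectralGap μ s) : poincareConst μ ≤ ENNReal.ofReal (1 / s) := by
  refine sInf_le fun f hf hfi hf0 => ?_
  simp only [enorm_gradient_sq, enorm_sq_eq_ofReal]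
  have hs' : 0 < 1 / s := by positivity
  by_cases hE : Integrable (gradSq f) μ
  swap
  · have : ∫⁻ x, ENNReal.ofReal (gradSq f x) ∂μ = ⊤ := by
      by_contra h
      refine hE ⟨hf.continuous_gradSq.aestronglyMeasurable, ?_⟩
      rw [hasFiniteIntegral_iff_ofReal (Eventually.of_forall (gradSq_nonneg f))]
      exact lt_top_iff_ne_top.2 h
    rw [this, ENNReal.mul_top (by simpa using hs)]
    exact le_top
  rw [← ofReal_integral_eq_lintegral_ofReal hE (Eventually.of_forall (gradSq_nonneg f)),
    ← ENNReal.ofReal_mul hs'.le]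
  set K := ∫ x, gradSq f x ∂μ with hK
  -- A smooth truncation: bounded, dominated by `|f|`, with gradient no longer than that of `f`, and
  -- converging pointwise to `f`.
  set g : ℕ → Euc n → ℝ := fun k x => ((k : ℝ) + 1) * Real.sin (f x / (k + 1)) with hg
  have hk0 : ∀ k : ℕ, (0 : ℝ) < (k : ℝ) + 1 := fun k => by positivity
  have hgs : ∀ k, ContDiff ℝ 1 (g k) := fun k =>
    contDiff_const.mul (Real.contDiff_sin.comp (hf.div_const _))
  have hgb : ∀ k, ∃ B, ∀ x, |g k x| ≤ B := fun k => ⟨(k : ℝ) + 1, fun x => by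
    rw [abs_mul, abs_of_pos (hk0 k)]
    exact mul_le_of_le_one_right (hk0 k).le (Real.abs_sin_le_one _)⟩
  have hgf : ∀ k x, |g k x| ≤ |f x| := fun k x => by
    have h1 : |Real.sin (f x / (k + 1))| ≤ |f x / (k + 1)| := Real.abs_sin_le_abs
    rw [abs_div, abs_of_pos (hk0 k), le_div_iff₀ (hk0 k)] at h1
    rw [abs_mul, abs_of_pos (hk0 k), mul_comm]
    exact h1
  have hpd : ∀ k i x, pd i (g k) x = Real.cos (f x / (k + 1)) * pd i f x := fun k i x => by
    have hd : DifferentiableAt ℝ f x := hf.differentiable (by norm_num) x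
    have h1 : HasFDerivAt (g k) (((k : ℝ) + 1) • (Real.cos (f x / (k + 1)) •
        (((k : ℝ) + 1)⁻¹ • fderiv ℝ f x))) x := by
      have h2 : HasFDerivAt (fun y => f y / ((k : ℝ) + 1)) (((k : ℝ) + 1)⁻¹ • fderiv ℝ f x) x := by
        simp only [div_eq_mul_inv]
        exact hd.hasFDerivAt.mul_const _
      exact h2.sin.const_mul _
    simp only [pd, h1.fderiv, smul_apply, smul_eq_mul]
    have := (hk0 k).ne'
    field_simp
  have hgrad : ∀ k x, gradSq (g k) x ≤ gradSq f x := fun k x => by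
    simp only [gradSq, hpd, mul_pow]
    refine Finset.sum_le_sum fun i _ => mul_le_of_le_one_left (sq_nonneg _) ?_
    exact Real.cos_sq_le_one _
  have hgE : ∀ k, Integrable (gradSq (g k)) μ := fun k =>
    hE.mono' (hgs k).continuous_gradSq.aestronglyMeasurable (Eventually.of_forall fun x => by
      rw [Real.norm_of_nonneg (gradSq_nonneg _ _)]
      exact hgrad k x)
  have hmean : Tendsto (fun k => ∫ x, g k x ∂μ) atTop (𝓝 0) := by
    rw [← hf0]
    exact tendsto_integral_of_dominated_convergence (fun x => |f x|)
      (fun k => (hgs k).continuous.aestronglyMeasurable) hfi.abs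
      (fun k => Eventually.of_forall (hgf k))
      (Eventually.of_forall fun x => tendsto_mul_sin_div (f x))
  have hbound : ∀ k, ∫⁻ x, ENNReal.ofReal (g k x ^ 2) ∂μ ≤
      ENNReal.ofReal (1 / s * K + (∫ x, g k x ∂μ) ^ 2) := fun k => by
    rw [← ofReal_integral_eq_lintegral_ofReal
      (memLp_of_abs_le (hgs k).continuous (hgb k)).integrable_sq
      (Eventually.of_forall fun x => sq_nonneg _)]
    refine ENNReal.ofReal_le_ofReal ?_
    have h1 := (hgap (g k) (hgs k) (hgb k) (hgE k)).trans (integral_mono (hgE k) hE (hgrad k))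
    rw [mul_comm, ← le_div_iff₀ hs] at h1
    rw [one_div_mul_eq_div]
    linarith
  -- Fatou's lemma, because `f` is only assumed integrable and not square integrable.
  calc ∫⁻ x, ENNReal.ofReal (f x ^ 2) ∂μ
      = ∫⁻ x, liminf (fun k => ENNReal.ofReal (g k x ^ 2)) atTop ∂μ := by
        refine lintegral_congr fun x => (Tendsto.liminf_eq ?_).symm
        exact (ENNReal.continuous_ofReal.tendsto _).comp ((tendsto_mul_sin_div (f x)).pow 2)
    _ ≤ liminf (fun k => ∫⁻ x, ENNReal.ofReal (g k x ^ 2) ∂μ) atTop :=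
        lintegral_liminf_le fun k => ((hgs k).continuous.pow 2).measurable.ennreal_ofReal
    _ ≤ liminf (fun k => ENNReal.ofReal (1 / s * K + (∫ x, g k x ∂μ) ^ 2)) atTop :=
        liminf_le_liminf (Eventually.of_forall hbound)
    _ = ENNReal.ofReal (1 / s * K) := by
        refine Tendsto.liminf_eq ((ENNReal.continuous_ofReal.tendsto _).comp ?_)
        simpa using tendsto_const_nhds.add (hmean.pow 2)

/-- The improved log-concave Lichnerowicz inequality. -/
theorem poincareConst_le_sqrt {μ : Measure (Euc n)} [IsProbabilityMeasure μ] {ψ : Euc n → ℝ} {t : ℝ}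
    (hμ : IsRegularLogConcave μ ψ) (ht0 : 0 < t) (ht : HessGE ψ t) :
    poincareConst μ ≤ ENNReal.ofReal (Real.sqrt (matOpNorm (covMat μ) * (1 / t))) := by
  have hψ : ContDiff ℝ ∞ ψ := hμ.temperate.1
  obtain rfl : μ = weighted ψ := hμ.density
  set V := matOpNorm (covMat (weighted ψ)) with hV
  have hV0 : 0 ≤ V := norm_nonneg _
  have key : ∀ s : ℝ, 0 < s → s ^ 2 * V ≤ t →
      poincareConst (weighted ψ) ≤ ENNReal.ofReal (1 / s) := fun s hs hst =>
    poincareConst_le_of_spectralGap hs (spectralGap_of_sq_mul_le hψ ht0 ht hs.le hst)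
  -- The choice `s = √(t / V)` requires `V > 0`. If `V = 0`, every positive `s` is admissible and `s
  -- → ∞` gives the bound 0.
  rcases hV0.eq_or_lt with h | h
  · rw [← h, zero_mul, Real.sqrt_zero]
    have hlim : Tendsto (fun s : ℝ => ENNReal.ofReal (1 / s)) atTop (𝓝 (ENNReal.ofReal 0)) :=
      (ENNReal.continuous_ofReal.tendsto 0).comp (tendsto_const_nhds.div_atTop tendsto_id)
    refine ge_of_tendsto hlim ((eventually_gt_atTop 0).mono fun s hs => key s hs ?_)
    rw [← h, mul_zero]
    exact ht0.le
  · have hs : 0 < √(t / V) := Real.sqrt_pos.2 (by positivity)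
    refine (key _ hs (le_of_eq ?_)).trans (le_of_eq ?_)
    · rw [Real.sq_sqrt (by positivity)]
      field_simp
    · congr 1
      rw [one_div, ← Real.sqrt_inv]
      congr 1
      rw [inv_div, mul_one_div]

end Poincare

/-! ### Gaussian measures -/

section Gaussian

open Filter Topology
open scoped MatrixOrder

variable {n : ℕ}

lemma integrable_exp_neg_half_norm_sq (n : ℕ) :
    Integrable (fun x : Euc n => Real.exp (-(‖x‖ ^ 2 / 2))) := by
  have h := (GaussianFourier.integrable_cexp_neg_mul_sq_norm_add (V := Euc n)
    (b := ((1 / 2 : ℝ) : ℂ)) (by rw [Complex.ofReal_re]; norm_num) 0 0).norm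
  refine h.congr (Eventually.of_forall fun x => ?_)
  simp only [zero_mul, add_zero]
  rw [Complex.norm_exp]
  congr 1
  rw [← Complex.ofReal_neg, ← Complex.ofReal_pow, ← Complex.ofReal_mul, Complex.ofReal_re]
  ring

/-- The normalizing constant of the standard Gaussian density. -/
noncomputable def gaussianNorm (n : ℕ) : ℝ := ∫ x : Euc n, Real.exp (-(‖x‖ ^ 2 / 2))

lemma gaussianNorm_pos (n : ℕ) : 0 < gaussianNorm n :=
  integral_exp_pos (integrable_exp_neg_half_norm_sq n)

lemma exp_neg_stdPotential (x : Euc n) :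
    Real.exp (-(‖x‖ ^ 2 / 2 + Real.log (gaussianNorm n))) =
      (gaussianNorm n)⁻¹ * Real.exp (-(‖x‖ ^ 2 / 2)) := by
  rw [neg_add, Real.exp_add, Real.exp_neg (Real.log _), Real.exp_log (gaussianNorm_pos n), mul_comm]

/-- The density of the standard Gaussian measure. -/
lemma stdGaussian_eq_weighted (n : ℕ) :
    stdGaussian (Euc n) = weighted fun x => ‖x‖ ^ 2 / 2 + Real.log (gaussianNorm n) := by
  have hfin : IsFiniteMeasure (weighted fun x : Euc n => ‖x‖ ^ 2 / 2 + Real.log (gaussianNorm n)) := by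
    refine isFiniteMeasure_withDensity_ofReal ?_
    simp only [exp_neg_stdPotential]
    exact ((integrable_exp_neg_half_norm_sq n).const_mul _).2
  -- Characteristic functions are compared through one Gaussian Fourier integral; its value at
  -- frequency 0 identifies `gaussianNorm n`.
  refine Measure.ext_of_charFun ?_
  ext t
  rw [charFun_stdGaussian, charFun_apply, weighted,
    integral_withDensity_eq_integral_toReal_smul (by fun_prop) (by simp)]
  have hb : 0 < (((1 / 2 : ℝ) : ℂ)).re := by rw [Complex.ofReal_re]; norm_num
  have hZ : ((gaussianNorm n : ℝ) : ℂ) =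
      (↑Real.pi / ((1 / 2 : ℝ) : ℂ)) ^ ((Module.finrank ℝ (Euc n) : ℂ) / 2) := by
    have h := GaussianFourier.integral_cexp_neg_mul_sq_norm_add (V := Euc n) hb 0 0
    simp only [zero_mul, add_zero, ne_eq, OfNat.ofNat_ne_zero, not_false_eq_true, zero_pow,
      zero_div, Complex.exp_zero, mul_one] at h
    rw [← h, gaussianNorm, ← integral_complex_ofReal]
    refine integral_congr_ae (Eventually.of_forall fun x => ?_)
    simp only
    push_cast
    congr 1
    ring
  have h := GaussianFourier.integral_cexp_neg_mul_sq_norm_add (V := Euc n) hb Complex.I t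
  rw [← hZ] at h
  have hZ0 : ((gaussianNorm n : ℝ) : ℂ) ≠ 0 := by exact_mod_cast (gaussianNorm_pos n).ne'
  have e : ∀ x : Euc n,
      (ENNReal.ofReal (Real.exp (-(‖x‖ ^ 2 / 2 + Real.log (gaussianNorm n))))).toReal •
      Complex.exp ((inner ℝ x t : ℝ) * Complex.I) = ((gaussianNorm n : ℝ) : ℂ)⁻¹ *
        Complex.exp (-((1 / 2 : ℝ) : ℂ) * (‖x‖ : ℂ) ^ 2 + Complex.I * (inner ℝ t x : ℝ)) := by
    intro x
    rw [ENNReal.toReal_ofReal (Real.exp_pos _).le, exp_neg_stdPotential, Complex.real_smul,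
      Complex.exp_add, real_inner_comm x t]
    push_cast
    rw [mul_assoc]
    congr 2
    · congr 1
      ring
    · rw [mul_comm]
  simp only [e]
  rw [integral_const_mul, h, ← mul_assoc, inv_mul_cancel₀ hZ0, one_mul]
  congr 1
  rw [Complex.I_sq]
  push_cast
  ring

/-- Affine images of measures with density. -/
lemma map_affine_withDensity (A : Euc n ≃L[ℝ] Euc n) (m : Euc n) {f : Euc n → ENNReal}
    (hf : Measurable f) :
    (volume.withDensity f).map (fun x => m + A x) =
      volume.withDensity fun y => ENNReal.ofReal |(LinearMap.det (A : Euc n →ₗ[ℝ] Euc n))⁻¹| *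
        f (A.symm (y - m)) := by
  have hT : Measurable fun x => m + A x := by fun_prop
  have hdet : LinearMap.det (A : Euc n →ₗ[ℝ] Euc n) ≠ 0 :=
    (LinearEquiv.isUnit_det' A.toLinearEquiv).ne_zero
  have hvol : (volume : Measure (Euc n)).map (fun x => m + A x) =
      ENNReal.ofReal |(LinearMap.det (A : Euc n →ₗ[ℝ] Euc n))⁻¹| • volume := by
    have h1 : (volume : Measure (Euc n)).map A =
        ENNReal.ofReal |(LinearMap.det (A : Euc n →ₗ[ℝ] Euc n))⁻¹| • volume :=
      Measure.map_linearMap_addHaar_eq_smul_addHaar volume hdet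
    have h2 : (fun x => m + A x) = (fun y => m + y) ∘ A := rfl
    rw [h2, ← Measure.map_map (measurable_const_add m) (by fun_prop), h1, Measure.map_smul,
      map_add_left_eq_self]
  have hg : Measurable fun y => f (A.symm (y - m)) := by fun_prop
  ext s hs
  rw [Measure.map_apply hT hs, withDensity_apply _ (hT hs), withDensity_apply _ hs,
    lintegral_const_mul _ hg, ← smul_eq_mul, ← lintegral_smul_measure, ← Measure.restrict_smul, ← hvol,
    setLIntegral_map hs hg hT]
  refine setLIntegral_congr_fun (hT hs) fun x _ => ?_
  simp

/-- The potential of the image of the standard Gaussian measure under `x ↦ m + A x`. -/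
noncomputable def gaussianPotential (A : Euc n ≃L[ℝ] Euc n) (m : Euc n) : Euc n → ℝ :=
  fun y => ‖A.symm (y - m)‖ ^ 2 / 2 +
    (Real.log (gaussianNorm n) + Real.log |LinearMap.det (A : Euc n →ₗ[ℝ] Euc n)|)

lemma map_stdGaussian_eq_weighted (A : Euc n ≃L[ℝ] Euc n) (m : Euc n) :
    (stdGaussian (Euc n)).map (fun x => m + A x) = weighted (gaussianPotential A m) := by
  have hdet : LinearMap.det (A : Euc n →ₗ[ℝ] Euc n) ≠ 0 :=
    (LinearEquiv.isUnit_det' A.toLinearEquiv).ne_zero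
  rw [stdGaussian_eq_weighted, weighted, map_affine_withDensity A m (by fun_prop), weighted]
  congr 1
  ext y
  rw [← ENNReal.ofReal_mul (abs_nonneg _)]
  congr 1
  rw [gaussianPotential, ← add_assoc, neg_add _ (Real.log |_|), Real.exp_add,
    Real.exp_neg (Real.log |_|), Real.exp_log (abs_pos.2 hdet), abs_inv, mul_comm]

lemma hasTemperateGrowth_gaussianPotential (A : Euc n ≃L[ℝ] Euc n) (m : Euc n) :
    Function.HasTemperateGrowth (gaussianPotential A m) := by
  have h1 : Function.HasTemperateGrowth fun y : Euc n => A.symm (y - m) :=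
    (A.symm : Euc n →L[ℝ] Euc n).hasTemperateGrowth.comp
      (Function.HasTemperateGrowth.id.sub (Function.HasTemperateGrowth.const m))
  have h2 : Function.HasTemperateGrowth fun y : Euc n => ‖A.symm (y - m)‖ ^ 2 :=
    (Function.hasTemperateGrowth_norm_sq (Euc n)).comp h1
  have h3 := (h2.mul (Function.HasTemperateGrowth.const (1 / 2 : ℝ))).add
    (Function.HasTemperateGrowth.const
      (Real.log (gaussianNorm n) + Real.log |LinearMap.det (A : Euc n →ₗ[ℝ] Euc n)|))
  have he : gaussianPotential A m = (fun y => ‖A.symm (y - m)‖ ^ 2) * (fun _ => 1 / 2) +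
      fun _ => Real.log (gaussianNorm n) + Real.log |LinearMap.det (A : Euc n →ₗ[ℝ] Euc n)| := by
    ext y
    simp [gaussianPotential, div_eq_mul_inv]
  rw [he]
  exact h3

lemma hessForm_gaussianPotential (A : Euc n ≃L[ℝ] Euc n) (m x v : Euc n) :
    hessForm (gaussianPotential A m) x v = ‖A.symm v‖ ^ 2 := by
  have haff : ∀ y, HasFDerivAt (fun y : Euc n => A.symm (y - m)) (A.symm : Euc n →L[ℝ] Euc n) y :=
    fun y => (A.symm : Euc n →L[ℝ] Euc n).hasFDerivAt.comp y ((hasFDerivAt_id y).sub_const m)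
  have h1 : ∀ y w, fderiv ℝ (gaussianPotential A m) y w = inner ℝ (A.symm (y - m)) (A.symm w) := by
    intro y w
    have h := ((haff y).norm_sq.mul_const (1 / 2 : ℝ)).add_const
      (Real.log (gaussianNorm n) + Real.log |LinearMap.det (A : Euc n →ₗ[ℝ] Euc n)|)
    have he : gaussianPotential A m = fun y => ‖A.symm (y - m)‖ ^ 2 * (1 / 2 : ℝ) +
        (Real.log (gaussianNorm n) + Real.log |LinearMap.det (A : Euc n →ₗ[ℝ] Euc n)|) := by
      ext z
      simp [gaussianPotential, div_eq_mul_inv]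
    rw [he, h.fderiv]
    simp [inner_sub_left]
  have hs : ContDiff ℝ ∞ (gaussianPotential A m) := (hasTemperateGrowth_gaussianPotential A m).1
  have hd : DifferentiableAt ℝ (fderiv ℝ (gaussianPotential A m)) x :=
    (hs.fderiv_right (m := ∞) (by norm_num)).differentiable (by norm_num) x
  have h2 : fderiv ℝ (fun y => fderiv ℝ (gaussianPotential A m) y v) x v =
      hessForm (gaussianPotential A m) x v := by
    rw [fderiv_clm_apply hd (differentiableAt_const _)]
    simp [hessForm]
  rw [← h2]
  simp only [h1]
  have h3 := (haff x).inner ℝ (hasFDerivAt_const (A.symm v) x)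
  rw [h3.fderiv]
  simp [fderivInnerCLM_apply]

/-- The Hessian form is `‖A.symm v‖ ^ 2`, pinched between multiples of `‖v‖ ^ 2` by the operator
norms of `A` and its inverse. Nontriviality of the space makes both norms positive. -/
lemma isRegularLogConcave_gaussianPotential [Nontrivial (Euc n)] (A : Euc n ≃L[ℝ] Euc n)
    (m : Euc n) : IsRegularLogConcave (weighted (gaussianPotential A m)) (gaussianPotential A m) := by
  refine ⟨rfl, hasTemperateGrowth_gaussianPotential A m, ?_⟩
  have hA : 0 < ‖(A : Euc n →L[ℝ] Euc n)‖ := A.norm_pos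
  have hB : 0 < ‖(A.symm : Euc n →L[ℝ] Euc n)‖ := A.symm.norm_pos
  set a := ‖(A : Euc n →L[ℝ] Euc n)‖
  set b := ‖(A.symm : Euc n →L[ℝ] Euc n)‖
  refine ⟨min (1 / a ^ 2) (1 / b ^ 2), by positivity, fun x v => ?_, fun x v => ?_⟩
  · rw [hessForm_gaussianPotential]
    have h1 : ‖v‖ ≤ a * ‖A.symm v‖ := by
      simpa using (A : Euc n →L[ℝ] Euc n).le_opNorm (A.symm v)
    calc _ ≤ 1 / a ^ 2 * ‖v‖ ^ 2 := by gcongr; exact min_le_left _ _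
      _ ≤ 1 / a ^ 2 * (a * ‖A.symm v‖) ^ 2 := by gcongr
      _ = _ := by field_simp
  · rw [hessForm_gaussianPotential]
    have h1 : ‖A.symm v‖ ≤ b * ‖v‖ := (A.symm : Euc n →L[ℝ] Euc n).le_opNorm v
    calc _ ≤ (b * ‖v‖) ^ 2 := by gcongr
      _ = b ^ 2 * ‖v‖ ^ 2 := by ring
      _ ≤ _ := by
        gcongr
        rw [le_one_div (by positivity) (by positivity)]
        exact min_le_right _ _

/-- Testing a Hessian bound at `v = A w` turns it into an upper bound for the operator norm of `A`.
-/
lemma isGreatest_hessGE_gaussianPotential [Nontrivial (Euc n)] (A : Euc n ≃L[ℝ] Euc n)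
    (m : Euc n) : IsGreatest {r : ℝ | HessGE (gaussianPotential A m) r}
      (1 / ‖(A : Euc n →L[ℝ] Euc n)‖ ^ 2) := by
  have hA : 0 < ‖(A : Euc n →L[ℝ] Euc n)‖ := A.norm_pos
  set a := ‖(A : Euc n →L[ℝ] Euc n)‖ with ha
  refine ⟨fun x v => ?_, fun r hr => ?_⟩
  · rw [hessForm_gaussianPotential]
    have h1 : ‖v‖ ≤ a * ‖A.symm v‖ := by
      simpa using (A : Euc n →L[ℝ] Euc n).le_opNorm (A.symm v)
    calc _ ≤ 1 / a ^ 2 * (a * ‖A.symm v‖) ^ 2 := by gcongr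
      _ = _ := by field_simp
  · rcases le_or_gt r 0 with h0 | h0
    · exact h0.trans (by positivity)
    · have hle : a ≤ √(1 / r) := by
        refine ContinuousLinearMap.opNorm_le_bound _ (Real.sqrt_nonneg _) fun w => ?_
        have h := hr 0 (A w)
        rw [hessForm_gaussianPotential, A.symm_apply_apply] at h
        rw [← Real.sqrt_sq (norm_nonneg w), ← Real.sqrt_mul (by positivity)]
        refine Real.le_sqrt_of_sq_le ?_
        rw [one_div_mul_eq_div, le_div_iff₀ h0, mul_comm]
        exact h
      rw [le_one_div h0 (by positivity)]
      exact (Real.le_sqrt hA.le (by positivity)).1 hle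

/-- A Gaussian measure is determined by its mean and covariance matrix. -/
lemma isGaussian_eq_multivariateGaussian (μ : Measure (Euc n)) [IsGaussian μ]
    (hS : (covMat μ).PosSemidef) : μ = multivariateGaussian (∫ x, x ∂μ) (covMat μ) := by
  apply IsGaussian.ext
  · simp
  rw [← ContinuousLinearMap.toBilinForm_inj]
  refine LinearMap.BilinForm.ext_basis (EuclideanSpace.basisFun (Fin n) ℝ).toBasis fun i j => ?_
  have hfun : ∀ i : Fin n, (fun u : Euc n => inner ℝ ((EuclideanSpace.basisFun (Fin n) ℝ).toBasis i) u) =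
      fun u => u i := fun i => by
    ext u
    simp [PiLp.inner_apply]
  rw [ContinuousLinearMap.toBilinForm_apply, ContinuousLinearMap.toBilinForm_apply,
    covarianceBilin_apply_eq_cov IsGaussian.memLp_two_id,
    covarianceBilin_apply_eq_cov IsGaussian.memLp_two_id, hfun, hfun,
    covariance_eval_multivariateGaussian hS]
  rfl

/-- Nondegenerate Gaussian measures are affine images of the standard one. -/
lemma exists_eq_map_stdGaussian (μ : Measure (Euc n)) [IsGaussian μ] (hS : (covMat μ).PosDef) :
    ∃ (A : Euc n ≃L[ℝ] Euc n) (m : Euc n), μ = (stdGaussian (Euc n)).map (fun x => m + A x) ∧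
      matOpNorm (covMat μ) = ‖(A : Euc n →L[ℝ] Euc n)‖ ^ 2 ∧
      ∀ a, inner ℝ a (Matrix.toEuclideanCLM (n := Fin n) (𝕜 := ℝ) (covMat μ) a) = ‖A a‖ ^ 2 := by
  -- The linear part of the affine map is the square root of the covariance: invertible by
  -- definiteness, and self-adjoint, so that its square has the squared norm.
  have hsq : CFC.sqrt (covMat μ) * CFC.sqrt (covMat μ) = covMat μ :=
    CFC.sqrt_mul_sqrt_self _ hS.posSemidef.nonneg
  have hu : IsUnit (CFC.sqrt (covMat μ)) := isUnit_of_mul_isUnit_left (hsq ▸ hS.isUnit)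
  set T := Matrix.toEuclideanCLM (n := Fin n) (𝕜 := ℝ) (CFC.sqrt (covMat μ)) with hT
  have hsa : IsSelfAdjoint T := (CFC.sqrt_nonneg (covMat μ)).isSelfAdjoint.map _
  have hTT : Matrix.toEuclideanCLM (n := Fin n) (𝕜 := ℝ) (covMat μ) = T * T := by
    rw [hT, ← map_mul, hsq]
  obtain ⟨U, hU⟩ : IsUnit T := hu.map _
  have hA : ((ContinuousLinearEquiv.ofUnit U : Euc n ≃L[ℝ] Euc n) : Euc n →L[ℝ] Euc n) = T := hU
  refine ⟨ContinuousLinearEquiv.ofUnit U, ∫ x, x ∂μ, ?_, ?_, fun a => ?_⟩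
  · conv_lhs => rw [isGaussian_eq_multivariateGaussian μ hS.posSemidef]
    rw [multivariateGaussian, ← hT, ← hA]
    rfl
  · rw [matOpNorm, hTT, hA, hsa.norm_mul_self]
  · have h1 : (ContinuousLinearEquiv.ofUnit U : Euc n ≃L[ℝ] Euc n) a = T a := by rw [← hA]; rfl
    rw [h1, hTT, ContinuousLinearMap.mul_def, ContinuousLinearMap.comp_apply, ← real_inner_self_eq_norm_sq,
      ← ContinuousLinearMap.adjoint_inner_left T (T a) a, hsa.adjoint_eq]

/-- Linear functions give a lower bound for the Poincaré constant. -/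
lemma ofReal_sq_le_poincareConst {μ : Measure (Euc n)} [IsProbabilityMeasure μ]
    (hmem : ∀ i, MemLp (fun x : Euc n => x i) 2 μ) {T : Euc n →L[ℝ] Euc n}
    (hT : ∀ a, inner ℝ a (Matrix.toEuclideanCLM (n := Fin n) (𝕜 := ℝ) (covMat μ) a) = ‖T a‖ ^ 2) :
    ENNReal.ofReal (‖T‖ ^ 2) ≤ poincareConst μ := by
  refine le_sInf fun C hC => ?_
  by_cases hCtop : C = ⊤
  · rw [hCtop]
    exact le_top
  lift C to NNReal using hCtop
  -- The centred linear function with coefficients `a` has variance `‖T a‖ ^ 2` and constant squared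
  -- gradient `‖a‖ ^ 2`.
  have key : ∀ a, ‖T a‖ ^ 2 ≤ (C : ℝ) * ‖a‖ ^ 2 := fun a => by
    have hL := memLp_centeredLinear hmem a
    have h := hC (centeredLinear μ a) ((contDiff_centeredLinear μ a).of_le (by norm_num))
      (hL.integrable (by norm_num)) (integral_centeredLinear hmem a)
    have hg : ∀ x, gradSq (centeredLinear μ a) x = ‖a‖ ^ 2 := fun x => by
      rw [EuclideanSpace.norm_sq_eq, gradSq]
      simp [pd_centeredLinear]
    simp only [enorm_gradient_sq, enorm_sq_eq_ofReal, hg, lintegral_const, measure_univ,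
      mul_one] at h
    rw [← ofReal_integral_eq_lintegral_ofReal hL.integrable_sq
      (Eventually.of_forall fun x => sq_nonneg _), integral_centeredLinear_sq hmem, hT,
      ← ENNReal.ofReal_coe_nnreal, ← ENNReal.ofReal_mul C.coe_nonneg,
      ENNReal.ofReal_le_ofReal_iff (by positivity)] at h
    exact h
  rw [← ENNReal.ofReal_coe_nnreal]
  refine ENNReal.ofReal_le_ofReal ?_
  have hle : ‖T‖ ≤ √(C : ℝ) := by
    refine ContinuousLinearMap.opNorm_le_bound _ (Real.sqrt_nonneg _) fun a => ?_
    rw [← Real.sqrt_sq (norm_nonneg a), ← Real.sqrt_mul C.coe_nonneg]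
    exact Real.le_sqrt_of_sq_le (key a)
  exact (Real.le_sqrt (norm_nonneg _) C.coe_nonneg).1 hle

end Gaussian

/-! ### The inequality and its Gaussian equality case -/

theorem mainTheorem4 (n : ℕ) :
    (∀ (μ : Measure (Euc n)) [IsProbabilityMeasure μ] (ψ : Euc n → ℝ) (t : ℝ),
      IsRegularLogConcave μ ψ → 0 < t → HessGE ψ t →
      poincareConst μ ≤ ENNReal.ofReal (Real.sqrt (matOpNorm (covMat μ) * (1 / t)))) ∧
    (0 < n → ∀ (μ : Measure (Euc n)) [IsGaussian μ], (covMat μ).PosDef →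
      ∃ (ψ : Euc n → ℝ) (t : ℝ),
        IsRegularLogConcave μ ψ ∧ 0 < t ∧ IsGreatest {r : ℝ | HessGE ψ r} t ∧
        matOpNorm (covMat μ) = 1 / t ∧
        poincareConst μ = ENNReal.ofReal (matOpNorm (covMat μ)) ∧
        poincareConst μ = ENNReal.ofReal (Real.sqrt (matOpNorm (covMat μ) * (1 / t)))) := by
  refine ⟨fun μ _ ψ t hμ ht0 ht => poincareConst_le_sqrt hμ ht0 ht, fun hn μ _ hS => ?_⟩
  have : NeZero n := ⟨hn.ne'⟩
  have : Nontrivial (Euc n) := inferInstance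
  obtain ⟨A, m, hμ, hnorm, hquad⟩ := exists_eq_map_stdGaussian μ hS
  rw [map_stdGaussian_eq_weighted] at hμ
  have hA : 0 < ‖(A : Euc n →L[ℝ] Euc n)‖ := A.norm_pos
  have hreg : IsRegularLogConcave μ (gaussianPotential A m) := by
    rw [hμ]
    exact isRegularLogConcave_gaussianPotential A m
  have hgreat := isGreatest_hessGE_gaussianPotential A m
  have ht0 : 0 < 1 / ‖(A : Euc n →L[ℝ] Euc n)‖ ^ 2 := by positivity
  have hV : matOpNorm (covMat μ) = 1 / (1 / ‖(A : Euc n →L[ℝ] Euc n)‖ ^ 2) := by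
    rw [hnorm, one_div_one_div]
  have hsqrt : Real.sqrt (matOpNorm (covMat μ) * (1 / (1 / ‖(A : Euc n →L[ℝ] Euc n)‖ ^ 2))) =
      matOpNorm (covMat μ) := by
    rw [← hV, Real.sqrt_mul_self]
    exact norm_nonneg _
  have hmem : ∀ i, MemLp (fun x : Euc n => x i) 2 μ := by
    rw [hμ]
    exact memLp_coord_weighted hreg.temperate.1 ht0 hgreat.1
  -- The upper bound for Gaussians is the inequality itself: here `1 / t` equals the norm of the
  -- covariance, so the geometric mean collapses.
  have hle := poincareConst_le_sqrt hreg ht0 hgreat.1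
  rw [hsqrt] at hle
  have hge : ENNReal.ofReal (matOpNorm (covMat μ)) ≤ poincareConst μ := by
    rw [hnorm]
    exact ofReal_sq_le_poincareConst hmem hquad
  have heq := le_antisymm hle hge
  exact ⟨gaussianPotential A m, _, hreg, ht0, hgreat, hV, heq, by rw [hsqrt]; exact heq⟩
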